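/- Let $m,n$ be integers with $1\le m\le n$. For $f\in L^2(\mathbb{R}^n)$ let $\widehat f(\xi)=(2\pi)^{-n/2}\int e^{-ix\cdot\xi}f(x)\,dx$ be its Fourier transform (in the sense of Plancherel) and, when $\widehat f$ has compact support, $$e^{it\Delta}f(x)=(2\pi)^{-n/2}\int_{\mathbb{R}^n} e^{i(x\cdot\xi+t|\xi|^2)}\,\widehat f(\xi)\,d\xi .$$ There is a constant $C\ge 1$, depending only on $m$ and $n$, such that for every $R>1$ there exist a nonzero $f\in L^2(\mathbb{R}^n)$ with $\widehat f$ supported in the annulus $\{\xi\in\mathbb{R}^n: C^{-1}R\le|\xi|\le CR\}$ and a measurable set $E\subset B^n(0,1)$ with $$C^{-1}R^{-\frac{n-m}{2}}\le |E|\le C\,R^{-\frac{n-m}{2}}$$ such that for every $x=(x_1,\dots,x_n)\in E$ there is some $t\in\mathbb{R}$ with $$\Bigl|t+\frac{x_1}{2R}\Bigr|\le C R^{-3/2}\qquad\text{and}\qquad \frac{|e^{it\Delta}f(x)|}{\|f\|_{L^2}}\ \ge\ C^{-1}R^{\frac{m}{2(m+1)}}R^{\frac{n-m}{4}} .$$ 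-/

import Mathlib

open MeasureTheory
open scoped FourierTransform

noncomputable section

/-- The unitary Fourier transform
`f̂(ξ) = (2π)^{-n/2} ∫ e^{-i x·ξ} f(x) dx` of `f ∈ L²(ℝⁿ)`, in the sense of Plancherel.
Mathlib's `𝓕` on `L²` has the kernel `e^{-2πi x·ξ}`, whence the rescaling by `2π`. -/
def unitaryFourier {n : ℕ} (f : Lp (α := EuclideanSpace ℝ (Fin n)) ℂ 2 volume)
    (ξ : EuclideanSpace ℝ (Fin n)) : ℂ :=
  (((2 * Real.pi) ^ (-(n : ℝ) / 2) : ℝ) : ℂ) *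
    ((𝓕 f : Lp (α := EuclideanSpace ℝ (Fin n)) ℂ 2 volume) : EuclideanSpace ℝ (Fin n) → ℂ)
      ((2 * Real.pi)⁻¹ • ξ)

/-- `e^{itΔ} f(x) = (2π)^{-n/2} ∫ e^{i (x·ξ + t|ξ|²)} f̂(ξ) dξ`. The integral converges absolutely
at every point when `f̂` has compact support, since then `f̂ ∈ L¹`. -/
def schrodinger {n : ℕ} (t : ℝ) (f : Lp (α := EuclideanSpace ℝ (Fin n)) ℂ 2 volume)
    (x : EuclideanSpace ℝ (Fin n)) : ℂ :=
  (((2 * Real.pi) ^ (-(n : ℝ) / 2) : ℝ) : ℂ) *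
    ∫ ξ : EuclideanSpace ℝ (Fin n),
      Complex.exp (Complex.I * ((inner ℝ x ξ + t * ‖ξ‖ ^ 2 : ℝ) : ℂ)) * unitaryFourier f ξ

end

/-! Write n = k + 1 and m = d + 1. The Fourier transform of f is a tensor product, so the evolution
is a product of one-dimensional oscillatory integrals that share only the time t
(`exists_tensor_datum`). The first factor is the indicator of (R, R + √R]; it suffers no
cancellation when |x₀ + 2tR| ≲ R^{-1/2} and |t| ≲ 1/R, and the first condition pins t to within
R^{-3/2}. The last k - d factors are indicators of (0, √R], without cancellation when |x_j| ≲
R^{-1/2}; this accounts for the size of E. Each of these gains R^{1/4} over its L² norm.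

The d middle factors are unit bumps at D(k - l), k, l < M. When D²t = πa/q and Dx_j is close to
2πc/q, the integral is a quadratic Gauss sum of size M²/√q against an L² norm at most M^{3/2}: a
gain of √(M/q) (`le_norm_integral_fejerBump`). Expanding the quadratic phase in characters mod q
turns the sum into Gauss sums, all of modulus √q, averaged against the nonnegative weights
|`twistedDirichlet`|². One weight carries nearly all the mass, so the main term survives
(`exists_quadratic_fejer_main_term`).

With R = X^{2d+4}, take P ~ X, q ~ P^d, M ~ X^{d+1} and D ~ X^{d+3}. The first and middle gains
multiply to R^{1/4} X^{d/2} = X^{d+1} = R^{m/(2(m+1))}.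

E must fill a fixed proportion of its box. Dirichlet's theorem gives the middle coordinates of every
point a common denominator q ≤ P^d; discarding those q that are small or have φ(q)/q small loses at
most half of the box (`half_le_volume_iUnion_spaceSet`). For each remaining q the admissible
fractions a/q capture a fixed proportion of x₀ (`le_volume_timeSet`), and Fubini combines the two.
Bounded R needs no arithmetic: one unit bump per middle coordinate suffices. -/

/-! ### Plancherel and tensor product data. -/

/-- Every square integrable function is the unitary Fourier transform of some `f ∈ L²`. -/
theorem exists_unitaryFourier_ae_eq {n : ℕ} {F : EuclideanSpace ℝ (Fin n) → ℂ}
    (hF : MemLp F 2 volume) :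
    ∃ f : Lp (α := EuclideanSpace ℝ (Fin n)) ℂ 2 volume,
      unitaryFourier f =ᵐ[volume] F ∧ ‖f‖ ^ 2 = ∫ ξ, ‖F ξ‖ ^ 2 := by
  have hpi : (0 : ℝ) < 2 * Real.pi := by positivity
  set A : ℝ := (2 * Real.pi) ^ ((n : ℝ) / 2) with hA
  have hA0 : 0 < A := by positivity
  have hA2 : A ^ 2 = (2 * Real.pi) ^ n := by
    rw [hA, ← Real.rpow_natCast, ← Real.rpow_mul hpi.le, ← Real.rpow_natCast]
    congr 1; push_cast; ring
  have hqmp : ∀ c : ℝ, c ≠ 0 → Measure.QuasiMeasurePreserving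
      (fun u : EuclideanSpace ℝ (Fin n) => c • u) volume volume := by
    intro c hc
    refine ⟨measurable_const_smul c, ?_⟩
    rw [Measure.map_addHaar_smul volume hc]
    exact Measure.smul_absolutelyContinuous
  -- The dilation by 2π undoes the rescaling in `unitaryFourier`; the factor A = (2π)^{n/2} makes it
  -- an L² isometry.
  set G : EuclideanSpace ℝ (Fin n) → ℂ := fun u => (A : ℂ) * F ((2 * Real.pi) • u) with hG
  have hGn : ∀ u, ‖G u‖ ^ 2 = A ^ 2 * ‖F ((2 * Real.pi) • u)‖ ^ 2 := by
    intro u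
    rw [hG]; simp only [norm_mul, Complex.norm_real, Real.norm_of_nonneg hA0.le]; ring
  have hGm : AEStronglyMeasurable G volume :=
    (hF.aestronglyMeasurable.comp_quasiMeasurePreserving (hqmp _ hpi.ne')).const_mul _
  have hG2 : MemLp G 2 volume := by
    rw [memLp_two_iff_integrable_sq_norm hGm]
    simp only [hGn]
    refine Integrable.const_mul ?_ _
    exact ((memLp_two_iff_integrable_sq_norm hF.aestronglyMeasurable).1 hF).comp_smul hpi.ne'
  refine ⟨𝓕⁻ (hG2.toLp G), ?_, ?_⟩
  · have h1 : (fun ξ => (hG2.toLp G : EuclideanSpace ℝ (Fin n) → ℂ) ((2 * Real.pi)⁻¹ • ξ))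
        =ᵐ[volume] fun ξ => G ((2 * Real.pi)⁻¹ • ξ) :=
      (hqmp _ (inv_ne_zero hpi.ne')).ae_eq_comp hG2.coeFn_toLp
    filter_upwards [h1] with ξ hξ
    rw [unitaryFourier, FourierTransform.fourier_fourierInv_eq, hξ, hG]
    simp only [smul_smul, mul_inv_cancel₀ hpi.ne', one_smul]
    rw [← mul_assoc, ← Complex.ofReal_mul, hA, ← Real.rpow_add hpi]
    have : -(n : ℝ) / 2 + (n : ℝ) / 2 = 0 := by ring
    rw [this]; simp
  · have h0 : ‖(𝓕⁻ (hG2.toLp G) : Lp (α := EuclideanSpace ℝ (Fin n)) ℂ 2 volume)‖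
        = ‖hG2.toLp G‖ := by
      rw [← Lp.norm_fourier_eq, FourierTransform.fourier_fourierInv_eq]
    have h1 : ‖hG2.toLp G‖ ^ 2 = ∫ u, ‖G u‖ ^ 2 := by
      rw [Lp.norm_toLp, hG2.eLpNorm_eq_integral_rpow_norm (by simp) (by simp),
        ENNReal.toReal_ofReal (by positivity)]
      simp only [ENNReal.toReal_ofNat, Real.rpow_ofNat]
      rw [← Real.rpow_natCast, ← Real.rpow_mul (by positivity)]
      simp
    rw [h0, h1]
    simp only [hGn]
    rw [integral_const_mul, Measure.integral_comp_smul volume (fun ξ => ‖F ξ‖ ^ 2), hA2]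
    simp only [finrank_euclideanSpace, Fintype.card_fin, smul_eq_mul]
    rw [abs_of_pos (by positivity), ← mul_assoc, mul_inv_cancel₀ (by positivity), one_mul]

theorem integral_euclideanSpace_prod {n : ℕ} (g : Fin n → ℝ → ℂ) :
    ∫ ξ : EuclideanSpace ℝ (Fin n), ∏ j, g j (ξ j) = ∏ j, ∫ s, g j s := by
  rw [← integral_fintype_prod_volume_eq_prod (fun j => g j),
    ← (PiLp.volume_preserving_ofLp (Fin n)).integral_comp
      (MeasurableEquiv.toLp 2 (Fin n → ℝ)).symm.measurableEmbedding]

/-- Data whose Fourier transform is a tensor product: the evolution factorizes. -/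
theorem exists_tensor_datum {n : ℕ} (F : Fin n → ℝ → ℂ) (hF : ∀ j, MemLp (F j) 2 volume) :
    ∃ f : Lp (α := EuclideanSpace ℝ (Fin n)) ℂ 2 volume,
      (unitaryFourier f =ᵐ[volume] fun ξ => ∏ j, F j (ξ j)) ∧
      ‖f‖ ^ 2 = ∏ j, ∫ s, ‖F j s‖ ^ 2 ∧
      ∀ t x, schrodinger t f x = (((2 * Real.pi) ^ (-(n : ℝ) / 2) : ℝ) : ℂ) *
        ∏ j, ∫ s, Complex.exp (Complex.I * ((x j * s + t * s ^ 2 : ℝ) : ℂ)) * F j s := by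
  have hmp := PiLp.volume_preserving_ofLp (Fin n)
  have hmeas : AEStronglyMeasurable (fun ξ : EuclideanSpace ℝ (Fin n) => ∏ j, F j (ξ j)) volume := by
    have : AEStronglyMeasurable (fun y : Fin n → ℝ => ∏ j, F j (y j)) volume := by
      refine Finset.aestronglyMeasurable_fun_prod _ fun j _ => ?_
      exact (hF j).aestronglyMeasurable.comp_quasiMeasurePreserving
        (Measure.quasiMeasurePreserving_eval (μ := fun _ : Fin n => (volume : Measure ℝ)) j)
    exact this.comp_measurePreserving hmp
  have hprod : MemLp (fun ξ : EuclideanSpace ℝ (Fin n) => ∏ j, F j (ξ j)) 2 volume := by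
    rw [memLp_two_iff_integrable_sq_norm hmeas]
    have h : Integrable (fun y : Fin n → ℝ => ∏ j, ‖F j (y j)‖ ^ 2) volume :=
      Integrable.fintype_prod (f := fun j s => ‖F j s‖ ^ 2) fun j =>
        (memLp_two_iff_integrable_sq_norm (hF j).aestronglyMeasurable).1 (hF j)
    have h' := hmp.integrable_comp_of_integrable h
    refine h'.congr (Filter.Eventually.of_forall fun ξ => ?_)
    simp [norm_prod, Finset.prod_pow]
  obtain ⟨f, hf, hfn⟩ := exists_unitaryFourier_ae_eq hprod
  refine ⟨f, hf, ?_, fun t x => ?_⟩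
  · rw [hfn, ← integral_fintype_prod_volume_eq_prod (fun j s => ‖F j s‖ ^ 2),
      ← hmp.integral_comp (MeasurableEquiv.toLp 2 (Fin n → ℝ)).symm.measurableEmbedding]
    simp [norm_prod, Finset.prod_pow]
  · rw [schrodinger, ← integral_euclideanSpace_prod]
    congr 1
    refine integral_congr_ae ?_
    filter_upwards [hf] with ξ hξ
    rw [hξ, Finset.prod_mul_distrib, ← Complex.exp_sum, ← Finset.mul_sum, ← Complex.ofReal_sum]
    congr 5
    rw [Finset.sum_add_distrib, ← Finset.mul_sum, EuclideanSpace.real_norm_sq_eq,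
      PiLp.inner_apply]
    simp [mul_comm]

/-! ### Quadratic phases and Gauss sums modulo q. -/

/-- The quadratic phase `e^{iπ a k² / q}`; it has period `q` in `k` when `a q` is even. -/
noncomputable def quadPhase (a : ℤ) (q : ℕ) (k : ℤ) : ℂ :=
  Complex.exp (Complex.I * ((Real.pi * a * k ^ 2 / q : ℝ) : ℂ))

theorem norm_quadPhase (a : ℤ) (q : ℕ) (k : ℤ) : ‖quadPhase a q k‖ = 1 := by
  rw [quadPhase, mul_comm, Complex.norm_exp_ofReal_mul_I]

/-- The cross term of (u + v)² contributes e^{2πi a u v / q}, a genuine character of `ZMod q`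
whatever the parity of a q. -/
theorem quadPhase_add (a : ℤ) (q : ℕ) [NeZero q] (u v : ℤ) :
    quadPhase a q (u + v) = quadPhase a q u * quadPhase a q v *
      ZMod.stdAddChar ((a : ZMod q) * (u : ZMod q) * (v : ZMod q)) := by
  have hq : (q : ℂ) ≠ 0 := Nat.cast_ne_zero.2 (NeZero.ne q)
  have : ((a : ZMod q) * (u : ZMod q) * (v : ZMod q)) = ((a * u * v : ℤ) : ZMod q) := by push_cast; ring
  rw [this, ZMod.stdAddChar_coe, quadPhase, quadPhase, quadPhase, ← Complex.exp_add,
    ← Complex.exp_add]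
  congr 1
  push_cast
  field_simp
  ring

theorem quadPhase_mul_period {a : ℤ} {q : ℕ} [NeZero q] (haq : Even (a * q)) (z : ℤ) :
    quadPhase a q (q * z) = 1 := by
  have hq : (q : ℂ) ≠ 0 := Nat.cast_ne_zero.2 (NeZero.ne q)
  obtain ⟨b, hb⟩ := haq
  have hb' : (a : ℂ) * q = b + b := by exact_mod_cast congrArg (Int.cast : ℤ → ℂ) hb
  rw [quadPhase, Complex.exp_eq_one_iff]
  refine ⟨b * z ^ 2, ?_⟩
  push_cast
  have : Complex.I * (Real.pi * a * (q * z) ^ 2 / q) = (a * q) * (Complex.I * Real.pi * z ^ 2) := by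
    field_simp
  rw [this, hb']; ring

theorem quadPhase_eq_of_intCast_eq {a : ℤ} {q : ℕ} [NeZero q] (haq : Even (a * q)) {u v : ℤ}
    (h : (u : ZMod q) = v) : quadPhase a q u = quadPhase a q v := by
  obtain ⟨z, hz⟩ := (ZMod.intCast_eq_intCast_iff_dvd_sub v u q).1 h.symm
  have hu : u = v + q * z := by linarith
  rw [hu, quadPhase_add, quadPhase_mul_period haq]
  simp

/-- The quadratic phase as a function on `ZMod q`. -/
noncomputable def quadPhaseZMod (a : ℤ) (q : ℕ) (v : ZMod q) : ℂ := quadPhase a q v.cast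

theorem quadPhaseZMod_intCast {a : ℤ} {q : ℕ} [NeZero q] (haq : Even (a * q)) (k : ℤ) :
    quadPhaseZMod a q (k : ZMod q) = quadPhase a q k :=
  quadPhase_eq_of_intCast_eq haq (by simp)

theorem quadPhaseZMod_add {a : ℤ} {q : ℕ} [NeZero q] (haq : Even (a * q)) (u v : ZMod q) :
    quadPhaseZMod a q (u + v) =
      quadPhaseZMod a q u * quadPhaseZMod a q v * ZMod.stdAddChar ((a : ZMod q) * u * v) := by
  obtain ⟨u, rfl⟩ := ZMod.intCast_surjective u
  obtain ⟨v, rfl⟩ := ZMod.intCast_surjective v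
  rw [← Int.cast_add, quadPhaseZMod_intCast haq, quadPhaseZMod_intCast haq,
    quadPhaseZMod_intCast haq, quadPhase_add]

/-- Quadratic Gauss sums with linear term have modulus exactly `√q`. -/
theorem norm_dft_quadPhaseZMod {a : ℤ} {q : ℕ} [NeZero q] (haq : Even (a * q))
    (hcop : IsUnit (a : ZMod q)) (c : ZMod q) :
    ‖ZMod.dft (quadPhaseZMod a q) c‖ = √q := by
  have hn : ∀ v, quadPhaseZMod a q v * (starRingEnd ℂ) (quadPhaseZMod a q v) = 1 := by
    intro v
    rw [Complex.mul_conj, Complex.normSq_eq_norm_sq, quadPhaseZMod, norm_quadPhase]; simp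
  have hs : ∀ v : ZMod q, ZMod.stdAddChar v * (starRingEnd ℂ) (ZMod.stdAddChar v) = 1 := by
    intro v
    rw [Complex.mul_conj, Complex.normSq_eq_norm_sq, ZMod.stdAddChar_apply, Circle.norm_coe]; simp
  have key : ZMod.dft (quadPhaseZMod a q) c * (starRingEnd ℂ) (ZMod.dft (quadPhaseZMod a q) c)
      = q := by
    rw [ZMod.dft_apply, map_sum, Finset.sum_mul_sum, Finset.sum_comm]
    -- After the substitution x = v + u in the squared modulus, the phase is linear in v, and
    -- orthogonality leaves only u = 0 because a is a unit.
    have h1 : ∀ v u : ZMod q,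
        (ZMod.stdAddChar (-((v + u) * c)) • quadPhaseZMod a q (v + u)) *
          (starRingEnd ℂ) (ZMod.stdAddChar (-(v * c)) • quadPhaseZMod a q v) =
        (quadPhaseZMod a q u * ZMod.stdAddChar (-(u * c))) *
          ZMod.stdAddChar (v * ((a : ZMod q) * u)) := by
      intro v u
      have e1 : -((v + u) * c) = -(v * c) + -(u * c) := by ring
      have e2 : (a : ZMod q) * v * u = v * ((a : ZMod q) * u) := by ring
      rw [quadPhaseZMod_add haq, e1, e2, AddChar.map_add_eq_mul, smul_eq_mul, smul_eq_mul, map_mul (starRingEnd ℂ)]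
      linear_combination
        (quadPhaseZMod a q u * ZMod.stdAddChar (-(u * c)) *
          ZMod.stdAddChar (v * ((a : ZMod q) * u))) * (hn v) *
          (ZMod.stdAddChar (-(v * c)) * (starRingEnd ℂ) (ZMod.stdAddChar (-(v * c)))) +
        (quadPhaseZMod a q u * ZMod.stdAddChar (-(u * c)) *
          ZMod.stdAddChar (v * ((a : ZMod q) * u))) * (hs (-(v * c)))
    have h2 : ∀ v : ZMod q, ∑ x : ZMod q,
        (ZMod.stdAddChar (-(x * c)) • quadPhaseZMod a q x) *
          (starRingEnd ℂ) (ZMod.stdAddChar (-(v * c)) • quadPhaseZMod a q v) =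
        ∑ u : ZMod q, (quadPhaseZMod a q u * ZMod.stdAddChar (-(u * c))) *
          ZMod.stdAddChar (v * ((a : ZMod q) * u)) := by
      intro v
      rw [← Equiv.sum_comp (Equiv.addLeft v)]
      exact Finset.sum_congr rfl fun u _ => h1 v u
    rw [Finset.sum_congr rfl fun v _ => h2 v, Finset.sum_comm]
    have h3 : ∀ u : ZMod q, ∑ v : ZMod q,
        (quadPhaseZMod a q u * ZMod.stdAddChar (-(u * c))) *
          ZMod.stdAddChar (v * ((a : ZMod q) * u)) = if u = 0 then (q : ℂ) else 0 := by
      intro u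
      rw [← Finset.mul_sum, AddChar.sum_mulShift _ (ZMod.isPrimitive_stdAddChar q)]
      have : (a : ZMod q) * u = 0 ↔ u = 0 := hcop.mul_right_eq_zero
      by_cases hu : u = 0
      · subst hu
        simp [quadPhaseZMod, quadPhase, ZMod.card]
      · simp [this, hu]
    rw [Finset.sum_congr rfl fun u _ => h3 u]
    simp
  rw [Complex.mul_conj, Complex.normSq_eq_norm_sq] at key
  have : ‖ZMod.dft (quadPhaseZMod a q) c‖ ^ 2 = q := by exact_mod_cast key
  rw [← this, Real.sqrt_sq (norm_nonneg _)]

/-! ### Fejér-weighted quadratic exponential sums. -/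

theorem norm_exp_I_mul_sub_one_le (θ : ℝ) : ‖Complex.exp (Complex.I * (θ : ℂ)) - 1‖ ≤ |θ| := by
  simpa using Real.norm_exp_I_mul_ofReal_sub_one_le (x := θ)

/-- The exponential sum `∑_{k < M} e^{ikφ} χ(ck)`. -/
noncomputable def twistedDirichlet (q : ℕ) [NeZero q] (M : ℕ) (φ : ℝ) (c : ZMod q) : ℂ :=
  ∑ k ∈ Finset.range M, Complex.exp (Complex.I * ((k * φ : ℝ) : ℂ)) * ZMod.stdAddChar (c * (k : ZMod q))

theorem twistedDirichlet_mul_conj (q : ℕ) [NeZero q] (M : ℕ) (φ : ℝ) (c : ZMod q) :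
    ((‖twistedDirichlet q M φ c‖ ^ 2 : ℝ) : ℂ) =
      ∑ k ∈ Finset.range M, ∑ l ∈ Finset.range M,
        Complex.exp (Complex.I * ((((k : ℝ) - l) * φ : ℝ) : ℂ)) *
          ZMod.stdAddChar (c * ((k : ZMod q) - (l : ZMod q))) := by
  rw [← Complex.normSq_eq_norm_sq, ← Complex.mul_conj, twistedDirichlet, map_sum,
    Finset.sum_mul_sum]
  refine Finset.sum_congr rfl fun k _ => Finset.sum_congr rfl fun l _ => ?_
  have h1 : (starRingEnd ℂ) (ZMod.stdAddChar (c * (l : ZMod q))) =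
      ZMod.stdAddChar (-(c * (l : ZMod q))) := by
    rw [AddChar.map_neg_eq_conj]
  have h2 : c * ((k : ZMod q) - (l : ZMod q)) = c * (k : ZMod q) + -(c * (l : ZMod q)) := by ring
  rw [map_mul (starRingEnd ℂ), h1, ← Complex.exp_conj, h2, AddChar.map_add_eq_mul]
  have h3 : Complex.exp (Complex.I * ((((k : ℝ) - l) * φ : ℝ) : ℂ)) =
      Complex.exp (Complex.I * ((k * φ : ℝ) : ℂ)) *
        Complex.exp ((starRingEnd ℂ) (Complex.I * ((l * φ : ℝ) : ℂ))) := by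
    rw [← Complex.exp_add]
    congr 1
    simp only [map_mul, Complex.conj_I, Complex.conj_ofReal]
    push_cast; ring
  rw [h3]; ring

theorem card_filter_range_natCast_eq_le (q M : ℕ) [NeZero q] (k : ℕ) :
    (((Finset.range M).filter fun l : ℕ => ((l : ZMod q) = k)).card : ℝ) ≤ M / q + 1 := by
  have hq : 0 < q := NeZero.pos q
  have h1 : (Finset.range M).filter (fun l : ℕ => ((l : ZMod q) = k)) =
      (Finset.range M).filter (fun l : ℕ => l ≡ k [MOD q]) := by
    ext l; simp [ZMod.natCast_eq_natCast_iff]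
  rw [h1, ← Nat.count_eq_card_filter_range, Nat.count_modEq_card _ hq]
  have h2 : ((M / q : ℕ) : ℝ) ≤ M / q := Nat.cast_div_le
  push_cast
  split_ifs <;> linarith

/-- Orthogonality in c leaves the pairs k ≡ l mod q, at most M (M / q + 1) of them, each weighted by
q. The phases are dropped by the triangle inequality, so the bound is uniform in φ. -/
theorem sum_norm_sq_twistedDirichlet_le (q : ℕ) [NeZero q] (M : ℕ) (φ : ℝ) :
    ∑ c : ZMod q, ‖twistedDirichlet q M φ c‖ ^ 2 ≤ (M : ℝ) ^ 2 + q * M := by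
  have hq : (0 : ℝ) < q := Nat.cast_pos.2 (NeZero.pos q)
  have h1 : ((∑ c : ZMod q, ‖twistedDirichlet q M φ c‖ ^ 2 : ℝ) : ℂ) =
      ∑ k ∈ Finset.range M, ∑ l ∈ Finset.range M,
        Complex.exp (Complex.I * ((((k : ℝ) - l) * φ : ℝ) : ℂ)) *
          (if ((l : ZMod q) = k) then (q : ℂ) else 0) := by
    rw [Complex.ofReal_sum, Finset.sum_congr rfl fun c _ => twistedDirichlet_mul_conj q M φ c,
      Finset.sum_comm]
    refine Finset.sum_congr rfl fun k _ => ?_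
    rw [Finset.sum_comm]
    refine Finset.sum_congr rfl fun l _ => ?_
    rw [← Finset.mul_sum, AddChar.sum_mulShift _ (ZMod.isPrimitive_stdAddChar q)]
    simp only [sub_eq_zero, ZMod.card, eq_comm]
    congr 1
    split_ifs <;> simp
  have h2 : ∑ c : ZMod q, ‖twistedDirichlet q M φ c‖ ^ 2 =
      ‖((∑ c : ZMod q, ‖twistedDirichlet q M φ c‖ ^ 2 : ℝ) : ℂ)‖ := by
    rw [Complex.norm_real, Real.norm_of_nonneg (by positivity)]
  rw [h2, h1]
  calc _ ≤ ∑ k ∈ Finset.range M, ∑ l ∈ Finset.range M,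
        (if ((l : ZMod q) = k) then (q : ℝ) else 0) := by
        refine norm_sum_le_of_le _ fun k _ => norm_sum_le_of_le _ fun l _ => ?_
        rw [norm_mul, mul_comm Complex.I, Complex.norm_exp_ofReal_mul_I, one_mul]
        split_ifs <;> simp
    _ ≤ ∑ k ∈ Finset.range M, (q : ℝ) * (M / q + 1) := by
        refine Finset.sum_le_sum fun k _ => ?_
        rw [← Finset.sum_filter, Finset.sum_const, nsmul_eq_mul, mul_comm]
        exact mul_le_mul_of_nonneg_left (card_filter_range_natCast_eq_le q M k) hq.le
    _ = (M : ℝ) ^ 2 + q * M := by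
        rw [Finset.sum_const, Finset.card_range, nsmul_eq_mul]; field_simp

/-- Fourier inversion of the phase on `ZMod q`. Since only differences k - l occur, each character
enters through a squared modulus, hence with a nonnegative weight. -/
theorem quadratic_fejer_sum_eq {a : ℤ} {q : ℕ} [NeZero q] (haq : Even (a * q)) (M : ℕ) (φ : ℝ) :
    ∑ k ∈ Finset.range M, ∑ l ∈ Finset.range M, quadPhase a q ((k : ℤ) - l) *
        Complex.exp (Complex.I * ((((k : ℝ) - l) * φ : ℝ) : ℂ)) =
      ∑ c : ZMod q, (q : ℂ)⁻¹ * ZMod.dft (quadPhaseZMod a q) c *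
        ((‖twistedDirichlet q M φ c‖ ^ 2 : ℝ) : ℂ) := by
  have hinv : ∀ k : ℤ, quadPhase a q k = ∑ c : ZMod q,
      (q : ℂ)⁻¹ * (ZMod.stdAddChar (c * (k : ZMod q)) * ZMod.dft (quadPhaseZMod a q) c) := by
    intro k
    rw [← quadPhaseZMod_intCast haq k, ← Finset.mul_sum]
    conv_lhs => rw [← LinearEquiv.symm_apply_apply ZMod.dft (quadPhaseZMod a q)]
    rw [ZMod.invDFT_apply]
    simp
  simp only [twistedDirichlet_mul_conj, Finset.mul_sum]
  rw [Finset.sum_comm]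
  conv_rhs => rw [Finset.sum_comm]
  rw [Finset.sum_comm]
  refine Finset.sum_congr rfl fun k _ => ?_
  rw [Finset.sum_comm]
  refine Finset.sum_congr rfl fun l _ => ?_
  rw [hinv, Finset.sum_mul]
  refine Finset.sum_congr rfl fun c _ => ?_
  push_cast
  ring

/-- Near a rational point the quadratic Fejér sum is essentially its main term. -/
theorem exists_quadratic_fejer_main_term {a : ℤ} {q : ℕ} [NeZero q] (haq : Even (a * q))
    (hcop : IsUnit (a : ZMod q)) (c : ℤ) :
    ∃ G : ℂ, ‖G‖ = 1 / √q ∧ ∀ (M : ℕ) (φ δ : ℝ), M * |φ - 2 * Real.pi * c / q| ≤ δ →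
      ‖∑ k ∈ Finset.range M, ∑ l ∈ Finset.range M, quadPhase a q ((k : ℤ) - l) *
        Complex.exp (Complex.I * ((((k : ℝ) - l) * φ : ℝ) : ℂ)) - G * M ^ 2‖ ≤
        (4 * δ * M ^ 2 + q * M) / √q := by
  have hq : (0 : ℝ) < q := Nat.cast_pos.2 (NeZero.pos q)
  have hsq : (q : ℝ)⁻¹ * √q = 1 / √q := by
    field_simp; exact Real.sq_sqrt hq.le
  set H : ZMod q → ℂ := fun b => (q : ℂ)⁻¹ * ZMod.dft (quadPhaseZMod a q) b with hH
  have hHn : ∀ b, ‖H b‖ = 1 / √q := by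
    intro b
    rw [hH]
    simp only [norm_mul, norm_dft_quadPhaseZMod haq hcop, norm_inv, Complex.norm_natCast]
    exact hsq
  -- The character at -c cancels the rotation by 2πc/q, leaving a sum of M terms close to 1.
  set c' : ZMod q := ((-c : ℤ) : ZMod q) with hc'
  refine ⟨H c', hHn c', fun M φ δ hδ => ?_⟩
  set θ : ℝ := φ - 2 * Real.pi * c / q with hθ
  set B : ZMod q → ℝ := fun b => ‖twistedDirichlet q M φ b‖ ^ 2 with hB
  have hD : twistedDirichlet q M φ c' =
      ∑ k ∈ Finset.range M, Complex.exp (Complex.I * ((k * θ : ℝ) : ℂ)) := by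
    refine Finset.sum_congr rfl fun k _ => ?_
    have : c' * (k : ZMod q) = ((-c * k : ℤ) : ZMod q) := by rw [hc']; push_cast; ring
    rw [this, ZMod.stdAddChar_coe, ← Complex.exp_add, hθ]
    congr 1
    push_cast
    ring
  have hδ0 : 0 ≤ δ := le_trans (by positivity) hδ
  have hDM : ‖twistedDirichlet q M φ c' - M‖ ≤ M * δ := by
    have : twistedDirichlet q M φ c' - M =
        ∑ k ∈ Finset.range M, (Complex.exp (Complex.I * ((k * θ : ℝ) : ℂ)) - 1) := by
      rw [hD, Finset.sum_sub_distrib]; simp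
    rw [this]
    calc _ ≤ ∑ k ∈ Finset.range M, δ := by
          refine norm_sum_le_of_le _ fun k hk => ?_
          refine (norm_exp_I_mul_sub_one_le _).trans (le_trans ?_ hδ)
          rw [abs_mul, Nat.abs_cast]
          have : (k : ℝ) ≤ M := by exact_mod_cast (Finset.mem_range.1 hk).le
          gcongr
      _ = M * δ := by simp
  have hDle : ‖twistedDirichlet q M φ c'‖ ≤ M := by
    rw [hD]
    refine (norm_sum_le_of_le (f := fun k : ℕ => Complex.exp (Complex.I * ((k * θ : ℝ) : ℂ)))
      (n := fun _ => (1 : ℝ)) _ fun k _ => ?_).trans (by simp)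
    rw [mul_comm, Complex.norm_exp_ofReal_mul_I]
  have hBle : B c' ≤ (M : ℝ) ^ 2 := pow_le_pow_left₀ (norm_nonneg _) hDle 2
  have hBge : (M : ℝ) ^ 2 - 2 * δ * M ^ 2 ≤ B c' := by
    have h1 : (M : ℝ) - M * δ ≤ ‖twistedDirichlet q M φ c'‖ := by
      have := norm_sub_norm_le (M : ℂ) (twistedDirichlet q M φ c')
      rw [norm_sub_rev, Complex.norm_natCast] at this
      linarith
    have hM : (0 : ℝ) ≤ M := Nat.cast_nonneg M
    have h2 : 0 ≤ ((M : ℝ) - ‖twistedDirichlet q M φ c'‖) ^ 2 := sq_nonneg _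
    have h3 := mul_le_mul_of_nonneg_left h1 hM
    simp only [hB]
    nlinarith
  have hsum := sum_norm_sq_twistedDirichlet_le q M φ
  rw [quadratic_fejer_sum_eq haq]
  have hsplit : ∑ b : ZMod q, H b * ((B b : ℝ) : ℂ) - H c' * (M : ℂ) ^ 2 =
      ∑ b ∈ Finset.univ.erase c', H b * ((B b : ℝ) : ℂ)
        + H c' * ((B c' - (M : ℝ) ^ 2 : ℝ) : ℂ) := by
    rw [← Finset.sum_erase_add _ _ (Finset.mem_univ c')]
    push_cast; ring
  -- The total mass is at most M² + qM and c' takes at least (1 - 2δ) M² of it.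
  have hrest : ∑ b ∈ Finset.univ.erase c', B b ≤ 2 * δ * M ^ 2 + q * M := by
    have h := Finset.sum_erase_add Finset.univ B (Finset.mem_univ c')
    have h' : ∑ b, B b ≤ (M : ℝ) ^ 2 + q * M := hsum
    linarith
  change ‖∑ b : ZMod q, H b * ((B b : ℝ) : ℂ) - H c' * (M : ℂ) ^ 2‖ ≤ _
  rw [hsplit]
  calc _ ≤ ∑ b ∈ Finset.univ.erase c', (1 / √q) * B b + (1 / √q) * (2 * δ * M ^ 2) := by
        refine (norm_add_le _ _).trans (add_le_add (norm_sum_le_of_le _ fun b _ => ?_) ?_)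
        · rw [norm_mul, hHn, Complex.norm_real, Real.norm_of_nonneg (by positivity)]
        · rw [norm_mul, hHn, Complex.norm_real, Real.norm_eq_abs]
          refine mul_le_mul_of_nonneg_left ?_ (by positivity)
          rw [abs_le]; constructor <;> linarith [mul_nonneg hδ0 (sq_nonneg (M : ℝ))]
    _ ≤ (1 / √q) * (2 * δ * M ^ 2 + q * M) + (1 / √q) * (2 * δ * M ^ 2) := by
        rw [← Finset.mul_sum]
        gcongr
    _ = _ := by ring

/-! ### Bumps and their oscillatory integrals. -/

/-- The indicator function of `(b, b + w]`. -/
noncomputable def bump (b w : ℝ) : ℝ → ℂ := (Set.Ioc b (b + w)).indicator fun _ => 1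

/-- Translates of the unit bump by `D ℤ`, with Fejér weights. -/
noncomputable def fejerBump (M : ℕ) (D : ℝ) (s : ℝ) : ℂ :=
  ∑ k ∈ Finset.range M, ∑ l ∈ Finset.range M, bump (D * ((k : ℝ) - l)) 1 s

theorem memLp_bump (b w : ℝ) (p : ENNReal) : MemLp (bump b w) p volume :=
  memLp_indicator_const p measurableSet_Ioc 1 (Or.inr (by simp))

theorem memLp_fejerBump (M : ℕ) (D : ℝ) (p : ENNReal) : MemLp (fejerBump M D) p volume :=
  memLp_finsetSum _ fun _ _ => memLp_finsetSum _ fun _ _ => memLp_bump _ _ _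

theorem norm_bump (b w s : ℝ) : ‖bump b w s‖ = (Set.Ioc b (b + w)).indicator (fun _ => (1 : ℝ)) s := by
  simp only [bump, Set.indicator_apply]
  split_ifs <;> simp

theorem integral_norm_bump (b : ℝ) {w : ℝ} (hw : 0 ≤ w) : ∫ s, ‖bump b w s‖ = w := by
  simp only [norm_bump]
  rw [integral_indicator_const _ measurableSet_Ioc]
  simp [Measure.real, hw]

theorem integral_norm_sq_bump (b : ℝ) {w : ℝ} (hw : 0 ≤ w) : ∫ s, ‖bump b w s‖ ^ 2 = w := by
  refine Eq.trans ?_ (integral_norm_bump b hw)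
  congr 1
  ext s
  rw [norm_bump, Set.indicator_apply]
  split_ifs <;> simp

/-- For fixed k the unit intervals indexed by l are disjoint, as D ≥ 1, so each of the M inner sums
is at most 1 in modulus. -/
theorem norm_fejerBump_le (M : ℕ) {D : ℝ} (hD : 1 ≤ D) (s : ℝ) : ‖fejerBump M D s‖ ≤ M := by
  have h : ∀ k ∈ Finset.range M, ‖∑ l ∈ Finset.range M, bump (D * ((k : ℝ) - l)) 1 s‖ ≤ 1 := by
    intro k _
    refine (norm_sum_le _ _).trans ?_
    simp only [norm_bump, Set.indicator_apply]
    rw [← Finset.sum_filter, Finset.sum_const, nsmul_eq_mul, mul_one]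
    have : ((Finset.range M).filter fun l : ℕ =>
        s ∈ Set.Ioc (D * ((k : ℝ) - l)) (D * ((k : ℝ) - l) + 1)).card ≤ 1 := by
      rw [Finset.card_le_one]
      intro l hl l' hl'
      simp only [Finset.mem_filter, Set.mem_Ioc] at hl hl'
      by_contra hne
      rcases lt_or_gt_of_ne hne with h | h
      · have : (l : ℝ) + 1 ≤ l' := by exact_mod_cast h
        nlinarith
      · have : (l' : ℝ) + 1 ≤ l := by exact_mod_cast h
        nlinarith
    exact_mod_cast this
  exact (norm_sum_le_of_le _ h).trans (by simp)

/-- The sup norm is at most M and the L¹ norm at most M². -/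
theorem integral_norm_sq_fejerBump_le (M : ℕ) {D : ℝ} (hD : 1 ≤ D) :
    ∫ s, ‖fejerBump M D s‖ ^ 2 ≤ (M : ℝ) ^ 3 := by
  have hint : ∀ k l : ℕ, Integrable (fun s => ‖bump (D * ((k : ℝ) - l)) 1 s‖) volume := fun k l =>
    (memLp_one_iff_integrable.1 (memLp_bump _ _ 1)).norm
  calc ∫ s, ‖fejerBump M D s‖ ^ 2
      ≤ ∫ s, M * ∑ k ∈ Finset.range M, ∑ l ∈ Finset.range M, ‖bump (D * ((k : ℝ) - l)) 1 s‖ := by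
        refine integral_mono_of_nonneg (Filter.Eventually.of_forall fun s => by positivity) ?_
          (Filter.Eventually.of_forall fun s => ?_)
        · exact (integrable_finsetSum _ fun k _ => integrable_finsetSum _ fun l _ =>
            hint k l).const_mul _
        · have h1 := norm_fejerBump_le M hD s
          have h2 : ‖fejerBump M D s‖ ≤
              ∑ k ∈ Finset.range M, ∑ l ∈ Finset.range M, ‖bump (D * ((k : ℝ) - l)) 1 s‖ :=
            norm_sum_le_of_le _ fun k _ => norm_sum_le _ _
          simp only [sq]
          exact mul_le_mul h1 h2 (norm_nonneg _) (Nat.cast_nonneg M)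
    _ = (M : ℝ) ^ 3 := by
        rw [integral_const_mul, integral_finsetSum _ fun k _ => integrable_finsetSum _ fun l _ =>
            hint k l]
        have : ∀ k ∈ Finset.range M, ∫ s, ∑ l ∈ Finset.range M, ‖bump (D * ((k : ℝ) - l)) 1 s‖
            = M := by
          intro k _
          rw [integral_finsetSum _ fun l _ => hint k l]
          simp [integral_norm_bump]
        rw [Finset.sum_congr rfl this]
        simp; ring

theorem integral_mul_bump (g : ℝ → ℂ) (b : ℝ) {w : ℝ} (hw : 0 ≤ w) :
    ∫ s, g s * bump b w s = ∫ s in (0 : ℝ)..w, g (b + s) := by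
  rw [intervalIntegral.integral_comp_add_left, add_zero,
    intervalIntegral.integral_of_le (by linarith), ← integral_indicator measurableSet_Ioc]
  congr 1
  ext s
  simp only [bump, Set.indicator_apply]
  split_ifs <;> simp

theorem norm_integral_sub_le {g : ℝ → ℂ} (hg : Continuous g) {w B : ℝ} (hw : 0 ≤ w) {G : ℂ}
    (h : ∀ s, 0 ≤ s → s ≤ w → ‖g s - G‖ ≤ B) :
    ‖(∫ s in (0 : ℝ)..w, g s) - w * G‖ ≤ B * w := by
  have h1 : (∫ s in (0 : ℝ)..w, g s) - w * G = ∫ s in (0 : ℝ)..w, (g s - G) := by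
    rw [intervalIntegral.integral_sub (hg.intervalIntegrable _ _) (by simp)]
    simp
  rw [h1]
  refine (intervalIntegral.norm_integral_le_of_norm_le_const (C := B) fun s hs => ?_).trans_eq ?_
  · rw [Set.uIoc_of_le hw] at hs
    exact h s hs.1.le hs.2
  · rw [sub_zero, abs_of_nonneg hw]

/-- No cancellation over a bump on which the phase varies by at most `1/2`. -/
theorem half_le_norm_integral_bump {x t b w : ℝ} (hw : 0 ≤ w)
    (h : w * |x + 2 * t * b| + |t| * w ^ 2 ≤ 1 / 2) :
    w / 2 ≤ ‖∫ s, Complex.exp (Complex.I * ((x * s + t * s ^ 2 : ℝ) : ℂ)) * bump b w s‖ := by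
  rw [integral_mul_bump _ _ hw]
  set G : ℂ := Complex.exp (Complex.I * ((x * b + t * b ^ 2 : ℝ) : ℂ)) with hG
  have hGn : ‖G‖ = 1 := by rw [hG, mul_comm, Complex.norm_exp_ofReal_mul_I]
  have key := norm_integral_sub_le
    (g := fun s => Complex.exp (Complex.I * ((x * (b + s) + t * (b + s) ^ 2 : ℝ) : ℂ)))
    (by fun_prop) hw (G := G) (B := 1 / 2) (by
      intro s hs0 hsw
      have h1 : Complex.exp (Complex.I * ((x * (b + s) + t * (b + s) ^ 2 : ℝ) : ℂ)) =
          G * Complex.exp (Complex.I * ((s * (x + 2 * t * b) + t * s ^ 2 : ℝ) : ℂ)) := by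
        rw [hG, ← Complex.exp_add]; congr 1; push_cast; ring
      rw [h1]
      have h2 : G * Complex.exp (Complex.I * ((s * (x + 2 * t * b) + t * s ^ 2 : ℝ) : ℂ)) - G =
          G * (Complex.exp (Complex.I * ((s * (x + 2 * t * b) + t * s ^ 2 : ℝ) : ℂ)) - 1) := by ring
      rw [h2, norm_mul, hGn, one_mul]
      refine (norm_exp_I_mul_sub_one_le _).trans (le_trans ?_ h)
      refine (abs_add_le _ _).trans ?_
      rw [abs_mul, abs_mul, abs_of_nonneg hs0, abs_of_nonneg (sq_nonneg s)]
      gcongr)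
  have h3 := norm_sub_norm_le ((w : ℂ) * G)
    (∫ s in (0 : ℝ)..w, Complex.exp (Complex.I * ((x * (b + s) + t * (b + s) ^ 2 : ℝ) : ℂ)))
  rw [norm_sub_rev, norm_mul, hGn, Complex.norm_real, Real.norm_of_nonneg hw, mul_one] at h3
  linarith

/-- The Gauss sum lower bound for the Fejér-weighted bumps. -/
theorem le_norm_integral_fejerBump {a c : ℤ} {q M : ℕ} [NeZero q] (haq : Even (a * q))
    (hcop : IsUnit (a : ZMod q)) {D x t : ℝ} (hD : 0 ≤ D) (ht : D ^ 2 * t = Real.pi * a / q)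
    (hxt : |x| + |t| ≤ 5 / 16) (hqM : 16 * q ≤ M)
    (hδ : M * (|D * x - 2 * Real.pi * c / q| + 2 * D * |t|) ≤ 1 / 64) :
    (M : ℝ) ^ 2 / (2 * √q) ≤
      ‖∫ s, Complex.exp (Complex.I * ((x * s + t * s ^ 2 : ℝ) : ℂ)) * fejerBump M D s‖ := by
  have hq : (0 : ℝ) < q := Nat.cast_pos.2 (NeZero.pos q)
  have hsq : 0 < √(q : ℝ) := Real.sqrt_pos.2 hq
  have hqM' : (q : ℝ) ≤ M / 16 := by
    have : (16 : ℝ) * q ≤ M := by exact_mod_cast hqM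
    linarith
  obtain ⟨G, hG, hmain⟩ := exists_quadratic_fejer_main_term haq hcop c
  set T : ℝ → ℂ := fun φ => ∑ k ∈ Finset.range M, ∑ l ∈ Finset.range M,
    quadPhase a q ((k : ℤ) - l) * Complex.exp (Complex.I * ((((k : ℝ) - l) * φ : ℝ) : ℂ)) with hT
  -- With κ = k - l, the phase at Dκ + s splits as (sx + ts²) + D²t κ² + κ D(x + 2st). The offset s
  -- inside a bump only perturbs the linear frequency.
  have hphase : ∀ (s : ℝ) (k l : ℕ),
      Complex.exp (Complex.I * ((x * (D * ((k : ℝ) - l) + s) + t * (D * ((k : ℝ) - l) + s) ^ 2 : ℝ) : ℂ)) =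
      Complex.exp (Complex.I * ((s * x + t * s ^ 2 : ℝ) : ℂ)) * (quadPhase a q ((k : ℤ) - l) *
        Complex.exp (Complex.I * ((((k : ℝ) - l) * (D * (x + 2 * s * t)) : ℝ) : ℂ))) := by
    intro s k l
    rw [quadPhase, ← Complex.exp_add, ← Complex.exp_add, ← mul_add, ← mul_add, ← Complex.ofReal_add,
      ← Complex.ofReal_add]
    congr 3
    have : Real.pi * a * (((k : ℤ) - l : ℤ) : ℝ) ^ 2 / q = (D ^ 2 * t) * ((k : ℝ) - l) ^ 2 := by
      rw [ht]; push_cast; ring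
    rw [this]; ring
  have hbdd : ∀ (b : ℝ), Integrable (fun s : ℝ =>
      Complex.exp (Complex.I * ((x * s + t * s ^ 2 : ℝ) : ℂ)) * bump b 1 s) volume := by
    intro b
    refine (memLp_one_iff_integrable.1 (memLp_bump b 1 1)).bdd_mul (c := 1) ?_ ?_
    · exact Continuous.aestronglyMeasurable (by fun_prop)
    · refine Filter.Eventually.of_forall fun s => ?_
      rw [mul_comm, Complex.norm_exp_ofReal_mul_I]
  have hI : ∫ s, Complex.exp (Complex.I * ((x * s + t * s ^ 2 : ℝ) : ℂ)) * fejerBump M D s =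
      ∫ s in (0 : ℝ)..1, Complex.exp (Complex.I * ((s * x + t * s ^ 2 : ℝ) : ℂ)) *
        T (D * (x + 2 * s * t)) := by
    simp only [fejerBump, Finset.mul_sum, hT]
    rw [integral_finsetSum _ fun k _ => integrable_finsetSum _ fun l _ => hbdd _,
      intervalIntegral.integral_finsetSum fun k _ => Continuous.intervalIntegrable (by fun_prop) _ _]
    refine Finset.sum_congr rfl fun k _ => ?_
    rw [integral_finsetSum _ fun l _ => hbdd _,
      intervalIntegral.integral_finsetSum fun l _ => Continuous.intervalIntegrable (by fun_prop) _ _]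
    refine Finset.sum_congr rfl fun l _ => ?_
    rw [integral_mul_bump _ _ zero_le_one]
    exact intervalIntegral.integral_congr fun s _ => hphase s k l
  -- Here 1/8 = 4 · (1/64) + 1/16: δ = 1/64, and q ≤ M / 16.
  have hTmain : ∀ s : ℝ, 0 ≤ s → s ≤ 1 →
      ‖T (D * (x + 2 * s * t)) - G * M ^ 2‖ ≤ (1 / 8) * (M ^ 2 / √q) := by
    intro s hs0 hs1
    have h1 := hmain M (D * (x + 2 * s * t)) (1 / 64) (by
      refine le_trans ?_ hδ
      gcongr
      have : D * (x + 2 * s * t) - 2 * Real.pi * c / q =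
          (D * x - 2 * Real.pi * c / q) + 2 * D * (s * t) := by ring
      rw [this]
      refine (abs_add_le _ _).trans ?_
      gcongr
      rw [abs_mul, abs_mul s, abs_of_nonneg hs0, abs_of_nonneg (by positivity : 0 ≤ 2 * D)]
      have : s * |t| ≤ 1 * |t| := by gcongr
      rw [one_mul] at this
      gcongr)
    refine h1.trans ?_
    rw [← mul_div_assoc (1 / 8 : ℝ), div_le_div_iff_of_pos_right hsq]
    have : (q : ℝ) * M ≤ M / 16 * M := by gcongr
    linarith
  have hGM : ‖G * (M : ℂ) ^ 2‖ = M ^ 2 / √q := by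
    rw [norm_mul, hG, norm_pow, Complex.norm_natCast]; ring
  set Z : ℝ := M ^ 2 / √q with hZ
  have hZ0 : 0 ≤ Z := by positivity
  -- The errors are 1/8 from the exponential sum and 5/16 from the outer phase, together 7/16 ≤ 1/2.
  have key := norm_integral_sub_le
    (g := fun s => Complex.exp (Complex.I * ((s * x + t * s ^ 2 : ℝ) : ℂ)) *
        T (D * (x + 2 * s * t)))
    (by simp only [hT]; fun_prop) zero_le_one (G := G * M ^ 2) (B := Z / 2) (by
      intro s hs0 hs1
      have h1 : Complex.exp (Complex.I * ((s * x + t * s ^ 2 : ℝ) : ℂ)) *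
          T (D * (x + 2 * s * t)) - G * M ^ 2 =
          Complex.exp (Complex.I * ((s * x + t * s ^ 2 : ℝ) : ℂ)) *
            (T (D * (x + 2 * s * t)) - G * M ^ 2) +
          (Complex.exp (Complex.I * ((s * x + t * s ^ 2 : ℝ) : ℂ)) - 1) * (G * M ^ 2) := by ring
      rw [h1]
      refine (norm_add_le _ _).trans ?_
      rw [norm_mul, norm_mul, hGM, mul_comm Complex.I, Complex.norm_exp_ofReal_mul_I, one_mul,
        mul_comm _ Complex.I]
      have h2 : ‖Complex.exp (Complex.I * ((s * x + t * s ^ 2 : ℝ) : ℂ)) - 1‖ ≤ 5 / 16 := by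
        refine (norm_exp_I_mul_sub_one_le _).trans (le_trans ?_ hxt)
        refine (abs_add_le _ _).trans ?_
        rw [abs_mul, abs_mul, abs_of_nonneg hs0, abs_of_nonneg (sq_nonneg s)]
        have e1 : s * |x| ≤ 1 * |x| := by gcongr
        have e2 : |t| * s ^ 2 ≤ |t| * 1 ^ 2 := by gcongr
        linarith
      have h3 := mul_le_mul_of_nonneg_right h2 hZ0
      have h4 := hTmain s hs0 hs1
      linarith)
  rw [hI]
  have h3 := norm_sub_norm_le (((1 : ℝ) : ℂ) * (G * (M : ℂ) ^ 2))
    (∫ s in (0 : ℝ)..1, Complex.exp (Complex.I * ((s * x + t * s ^ 2 : ℝ) : ℂ)) *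
        T (D * (x + 2 * s * t)))
  rw [norm_sub_rev, norm_mul, hGM, Complex.norm_real] at h3
  have h5 : (M : ℝ) ^ 2 / (2 * √q) = Z / 2 := by rw [hZ]; field_simp
  rw [h5]
  simp only [norm_one, one_mul, mul_one] at h3 key
  simp only [Complex.ofReal_one, one_mul] at h3 key
  linarith

/-! ### Simultaneous approximation and denominators with large totient. -/

/-- Dirichlet's theorem on simultaneous approximation. -/
theorem exists_simultaneous_approx {ι : Type*} [Fintype ι] [DecidableEq ι] (y : ι → ℝ) {P : ℕ} (hP : 0 < P) :
    ∃ q : ℕ, 1 ≤ q ∧ q ≤ P ^ Fintype.card ι ∧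
      ∃ c : ι → ℤ, ∀ j, |y j - c j / q| ≤ 1 / (q * P) := by
  have hP' : (0 : ℝ) < P := Nat.cast_pos.2 hP
  have hlt : ∀ (k : ℕ) (j : ι), ⌊P * Int.fract (k * y j)⌋₊ < P := by
    intro k j
    rw [Nat.floor_lt (by positivity)]
    have := Int.fract_lt_one ((k : ℝ) * y j)
    nlinarith
  -- Pigeonhole: one more multiple of y than there are boxes of side 1/P; q is the difference of two
  -- multiples in the same box.
  let f : Fin (P ^ Fintype.card ι + 1) → (ι → Fin P) := fun k j =>
    ⟨⌊P * Int.fract ((k : ℕ) * y j)⌋₊, hlt k j⟩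
  obtain ⟨k, l, hne, hkl⟩ := Fintype.exists_ne_map_eq_of_card_lt f (by simp)
  wlog h : k < l generalizing k l
  · exact this l k hne.symm hkl.symm (lt_of_le_of_ne (not_lt.1 h) hne.symm)
  have h' : (k : ℕ) < l := h
  refine ⟨l - k, by omega, by have := l.2; omega,
    fun j => ⌊((l : ℕ) : ℝ) * y j⌋ - ⌊((k : ℕ) : ℝ) * y j⌋, fun j => ?_⟩
  have hq : (((l : ℕ) - (k : ℕ) : ℕ) : ℝ) = (l : ℕ) - (k : ℕ) := Nat.cast_sub h'.le
  have hq0 : (0 : ℝ) < (((l : ℕ) - (k : ℕ) : ℕ) : ℝ) := Nat.cast_pos.2 (by omega)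
  have hj : ⌊P * Int.fract ((k : ℕ) * y j)⌋₊ = ⌊P * Int.fract ((l : ℕ) * y j)⌋₊ := by
    have := congrFun hkl j
    simpa [f] using this
  have h1 := Nat.floor_le (a := P * Int.fract ((k : ℕ) * y j))
    (mul_nonneg hP'.le (Int.fract_nonneg _))
  have h2 := Nat.lt_floor_add_one (P * Int.fract ((k : ℕ) * y j))
  have h3 := Nat.floor_le (a := P * Int.fract ((l : ℕ) * y j))
    (mul_nonneg hP'.le (Int.fract_nonneg _))
  have h4 := Nat.lt_floor_add_one (P * Int.fract ((l : ℕ) * y j))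
  rw [← hj] at h3 h4
  have h5 : |P * (Int.fract ((l : ℕ) * y j) - Int.fract ((k : ℕ) * y j))| ≤ 1 := by
    rw [abs_le]; constructor <;> linarith
  set q : ℝ := (((l : ℕ) - (k : ℕ) : ℕ) : ℝ) with hqdef
  have h6 : y j - ((⌊((l : ℕ) : ℝ) * y j⌋ - ⌊((k : ℕ) : ℝ) * y j⌋ : ℤ) : ℝ) / q =
      (P * (Int.fract ((l : ℕ) * y j) - Int.fract ((k : ℕ) * y j))) / (q * P) := by
    simp only [Int.fract]
    field_simp
    rw [hq]; push_cast; ring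
  rw [h6, abs_div, abs_of_pos (by positivity : 0 < q * P)]
  gcongr

/-- The sum of the reciprocals of the prime factors of `q`. -/
noncomputable def primeFactorsRecip (q : ℕ) : ℝ := ∑ r ∈ q.primeFactors, (r : ℝ)⁻¹

/-- Exchanging the sums, r divides at most Q / r of the q, so the total is at most Q ∑ r^{-2} over r
≥ 2. Primality is used only for r > 1. -/
theorem sum_primeFactorsRecip_le (Q : ℕ) :
    ∑ q ∈ Finset.Ioc 0 Q, primeFactorsRecip q ≤ Q := by
  have h1 : ∀ q ∈ Finset.Ioc 0 Q, primeFactorsRecip q ≤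
      ∑ r ∈ Finset.Ioc 1 Q, if r ∣ q then (r : ℝ)⁻¹ else 0 := by
    intro q hq
    rw [Finset.mem_Ioc] at hq
    rw [primeFactorsRecip, ← Finset.sum_filter]
    refine Finset.sum_le_sum_of_subset_of_nonneg (fun r hr => ?_) fun _ _ _ => by positivity
    have hr' := Nat.prime_of_mem_primeFactors hr
    have hd := Nat.dvd_of_mem_primeFactors hr
    simp only [Finset.mem_filter, Finset.mem_Ioc]
    exact ⟨⟨hr'.one_lt, (Nat.le_of_dvd hq.1 hd).trans hq.2⟩, hd⟩
  refine (Finset.sum_le_sum h1).trans ?_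
  rw [Finset.sum_comm]
  have h2 : ∀ r ∈ Finset.Ioc 1 Q, (∑ q ∈ Finset.Ioc 0 Q, if r ∣ q then (r : ℝ)⁻¹ else 0) ≤
      Q * ((r : ℝ) ^ 2)⁻¹ := by
    intro r _
    rw [← Finset.sum_filter, Finset.sum_const, Nat.Ioc_filter_dvd_card_eq_div, nsmul_eq_mul]
    have : ((Q / r : ℕ) : ℝ) ≤ Q / r := Nat.cast_div_le
    calc ((Q / r : ℕ) : ℝ) * (r : ℝ)⁻¹ ≤ (Q / r) * (r : ℝ)⁻¹ := by gcongr
      _ = _ := by rw [sq, mul_inv]; ring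
  refine (Finset.sum_le_sum h2).trans ?_
  rw [← Finset.mul_sum]
  rcases Nat.eq_zero_or_pos Q with rfl | hQ
  · simp
  have h3 := sum_Ioc_inv_sq_le_sub (α := ℝ) one_ne_zero hQ
  have h4 : (0 : ℝ) ≤ (Q : ℝ)⁻¹ := by positivity
  have h5 : ∑ i ∈ Finset.Ioc 1 Q, ((i : ℝ) ^ 2)⁻¹ ≤ 1 := by
    refine h3.trans ?_
    simp
  calc (Q : ℝ) * _ ≤ Q * 1 := by gcongr
    _ = Q := mul_one _

theorem card_primeFactorsRecip_gt_le (Q : ℕ) {K : ℝ} (hK : 0 < K) :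
    (((Finset.Ioc 0 Q).filter fun q => K < primeFactorsRecip q).card : ℝ) ≤ Q / K := by
  rw [le_div_iff₀ hK]
  calc _ = ∑ q ∈ (Finset.Ioc 0 Q).filter fun q => K < primeFactorsRecip q, K := by
        rw [Finset.sum_const, nsmul_eq_mul]
    _ ≤ ∑ q ∈ (Finset.Ioc 0 Q).filter fun q => K < primeFactorsRecip q, primeFactorsRecip q :=
        Finset.sum_le_sum fun q hq => (Finset.mem_filter.1 hq).2.le
    _ ≤ ∑ q ∈ Finset.Ioc 0 Q, primeFactorsRecip q :=
        Finset.sum_le_sum_of_subset_of_nonneg (Finset.filter_subset _ _) fun q _ _ =>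
          Finset.sum_nonneg fun r _ => by positivity
    _ ≤ Q := sum_primeFactorsRecip_le Q

/-- φ(q)/q is the product of 1 - 1/r over the primes r dividing q, and log(1 - u) ≥ -2u for 0 < u ≤
1/2. -/
theorem exp_mul_le_totient (q : ℕ) :
    Real.exp (-2 * primeFactorsRecip q) * q ≤ q.totient := by
  have h : (q.totient : ℝ) = q * ∏ r ∈ q.primeFactors, (1 - (r : ℝ)⁻¹) := by
    have := congrArg (Rat.cast : ℚ → ℝ) (Nat.totient_eq_mul_prod_factors q)
    push_cast at this
    exact this
  rw [h, mul_comm, primeFactorsRecip, Finset.mul_sum, Real.exp_sum]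
  gcongr with r hr
  have hr2 : (2 : ℝ) ≤ r := by exact_mod_cast (Nat.prime_of_mem_primeFactors hr).two_le
  have hinv : (r : ℝ)⁻¹ ≤ 1 / 2 := by
    rw [inv_eq_one_div]; gcongr
  have hpos : 0 < 1 - (r : ℝ)⁻¹ := by linarith
  have h0 : 0 < (r : ℝ)⁻¹ := by positivity
  rw [← Real.le_log_iff_exp_le hpos]
  refine le_trans ?_ (Real.one_sub_inv_le_log_of_pos hpos)
  have : (1 - (r : ℝ)⁻¹)⁻¹ ≤ 1 + 2 * (r : ℝ)⁻¹ := by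
    rw [inv_le_iff_one_le_mul₀ hpos]
    nlinarith
  linarith

theorem card_filter_coprime_range_mul (q J : ℕ) :
    ((Finset.range (q * J)).filter q.Coprime).card = J * q.totient := by
  induction J with
  | zero => simp
  | succ J ih =>
    have : Finset.range (q * (J + 1)) = Finset.range (q * J) ∪ Finset.Ico (q * J) (q * J + q) := by
      ext x; simp only [Finset.mem_range, Finset.mem_union, Finset.mem_Ico, mul_add, mul_one]; omega
    rw [this, Finset.filter_union, Finset.card_union_of_disjoint, ih,
      Nat.filter_coprime_Ico_eq_totient]
    · ring
    · refine Finset.disjoint_filter_filter ?_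
      rw [Finset.disjoint_left]
      intro x hx hx'
      simp only [Finset.mem_range, Finset.mem_Ico] at hx hx'
      omega

/-! ### Measures of the arithmetic sets. -/

/-- Points of `[0, ρ)` for which `D x / 2π` is within `1 / (q P)` of a fraction with
denominator `q`. -/
def approxSet (D ρ : ℝ) (P q : ℕ) : Set ℝ :=
  Set.Ico 0 ρ ∩ {x | ∃ c : ℤ, |D * x / (2 * Real.pi) - c / q| ≤ 1 / (q * P)}

/-- Points of `[0, ρ)` for which `x / lam` is within `1 / q` of a fraction `a / q` that is
admissible for the quadratic Gauss sum modulo `q`. -/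
def timeSet (lam ρ : ℝ) (q : ℕ) : Set ℝ :=
  Set.Ico 0 ρ ∩ {x | ∃ a : ℤ, IsUnit (a : ZMod q) ∧ Even (a * q) ∧ |x / lam - a / q| ≤ 1 / q}

theorem measurableSet_approxSet (D ρ : ℝ) (P q : ℕ) : MeasurableSet (approxSet D ρ P q) := by
  refine measurableSet_Ico.inter ?_
  rw [Set.ofPred_exists]
  refine MeasurableSet.iUnion fun c => measurableSet_le ?_ measurable_const
  fun_prop

theorem measurableSet_timeSet (lam ρ : ℝ) (q : ℕ) : MeasurableSet (timeSet lam ρ q) := by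
  refine measurableSet_Ico.inter ?_
  rw [Set.ofPred_exists]
  refine MeasurableSet.iUnion fun a => ?_
  simp only [Set.ofPred_and]
  refine (MeasurableSet.const _).inter ((MeasurableSet.const _).inter
    (measurableSet_le ?_ measurable_const))
  fun_prop

/-- With L = ρD/2π there are at most qL + 3 ≤ 4qL relevant numerators, each giving an interval of
length 4π/(DqP). The factor q cancels, so all denominators cost the same. -/
theorem volume_approxSet_le {D ρ : ℝ} {P q : ℕ} (hD : 0 < D) (hρ : 1 ≤ ρ * D / (2 * Real.pi))
    (hP : 0 < P) (hq : 0 < q) : volume (approxSet D ρ P q) ≤ ENNReal.ofReal (8 / P * ρ) := by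
  have hpi := Real.pi_pos
  have hP1 : (1 : ℝ) ≤ P := by exact_mod_cast hP
  have hq1 : (1 : ℝ) ≤ q := by exact_mod_cast hq
  set L : ℝ := ρ * D / (2 * Real.pi) with hL
  set s : Finset ℤ := Finset.Icc (-1) ⌊q * L + 1⌋ with hs
  have hsub : approxSet D ρ P q ⊆ ⋃ c ∈ s, Set.Icc (((c : ℝ) / q - 1 / (q * P)) * (2 * Real.pi / D))
      (((c : ℝ) / q + 1 / (q * P)) * (2 * Real.pi / D)) := by
    rintro x ⟨⟨hx0, hxρ⟩, c, hc⟩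
    have hx : x = (D * x / (2 * Real.pi)) * (2 * Real.pi / D) := by field_simp
    have hy0 : 0 ≤ D * x / (2 * Real.pi) := by positivity
    have hyL : D * x / (2 * Real.pi) ≤ L := by
      rw [hL, mul_comm D x]; gcongr
    set y := D * x / (2 * Real.pi) with hy
    rw [abs_le] at hc
    have hr : 1 / ((q : ℝ) * P) ≤ 1 / q := by
      gcongr; nlinarith
    have hcq : q * ((c : ℝ) / q) = c := by field_simp
    have hqq : q * (1 / (q : ℝ)) = 1 := by field_simp
    simp only [Set.mem_iUnion]
    refine ⟨c, ?_, ?_, ?_⟩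
    · rw [hs, Finset.mem_Icc]
      constructor
      · have : (-1 : ℝ) ≤ c := by
          have : q * ((c : ℝ) / q) ≥ q * (-(1 / q)) := by
            gcongr; linarith
          linarith
        exact_mod_cast this
      · rw [Int.le_floor]
        have : q * ((c : ℝ) / q) ≤ q * (L + 1 / q) := by
          gcongr; linarith
        linarith
    · rw [hx]; gcongr; linarith
    · rw [hx]; gcongr; linarith
  calc volume (approxSet D ρ P q) ≤ _ := measure_mono hsub
    _ ≤ ∑ c ∈ s, volume (Set.Icc (((c : ℝ) / q - 1 / (q * P)) * (2 * Real.pi / D))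
      (((c : ℝ) / q + 1 / (q * P)) * (2 * Real.pi / D))) := measure_biUnion_finset_le _ _
    _ = ∑ c ∈ s, ENNReal.ofReal (4 * Real.pi / (D * q * P)) := by
        refine Finset.sum_congr rfl fun c _ => ?_
        rw [Real.volume_Icc]
        congr 1
        field_simp
        ring
    _ = ENNReal.ofReal (s.card * (4 * Real.pi / (D * q * P))) := by
        rw [Finset.sum_const, nsmul_eq_mul, ENNReal.ofReal_mul (by positivity)]
        simp
    _ ≤ ENNReal.ofReal (8 / P * ρ) := by
        refine ENNReal.ofReal_le_ofReal ?_
        have hcard : (s.card : ℝ) ≤ 4 * (q * L) := by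
          have h0 : (0 : ℝ) ≤ q * L + 1 := by positivity
          have hfl : 0 ≤ ⌊q * L + 1⌋ := Int.floor_nonneg.2 h0
          have h1 : (s.card : ℤ) = ⌊q * L + 1⌋ + 2 := by
            rw [hs, Int.card_Icc, Int.toNat_of_nonneg (by omega)]; ring
          have h2 : (s.card : ℝ) = (⌊q * L + 1⌋ : ℝ) + 2 := by exact_mod_cast h1
          have h3 := Int.floor_le (q * L + 1)
          nlinarith
        calc (s.card : ℝ) * (4 * Real.pi / (D * q * P)) ≤ (4 * (q * L)) * (4 * Real.pi / (D * q * P)) := by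
              gcongr
          _ = 8 / P * ρ := by rw [hL]; field_simp; ring

/-- The set contains disjoint intervals of length lam / q, one for each b < qJ coprime to q; there
are J φ(q) of them. -/
theorem le_volume_timeSet {lam ρ η : ℝ} {q : ℕ} (hlam : 0 < lam) (hρ : 2 * lam ≤ ρ) (hq : 0 < q)
    (hη : η * q ≤ q.totient) (hη0 : 0 ≤ η) :
    ENNReal.ofReal (η * ρ / 4) ≤ volume (timeSet lam ρ q) := by
  have hq0 : (0 : ℝ) < q := Nat.cast_pos.2 hq
  set J : ℕ := ⌊ρ / lam / 2⌋₊ with hJ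
  have hL : 1 ≤ ρ / lam / 2 := by
    rw [div_div, le_div_iff₀ (by positivity)]; linarith
  have hJle : (J : ℝ) ≤ ρ / lam / 2 := Nat.floor_le (by linarith)
  have hJge : ρ / lam / 4 ≤ J := by
    have h1 := Nat.lt_floor_add_one (ρ / lam / 2)
    have h2 : (1 : ℝ) ≤ J := by
      exact_mod_cast (Nat.one_le_floor_iff _).2 hL
    rw [← hJ] at h1
    linarith
  -- Parity of a q: for odd q the numerators 2b are even and still coprime to q; for even q nothing
  -- is needed. The extra 1/2 in J leaves room for the doubling.
  set σ : ℕ := if Odd q then 2 else 1 with hσ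
  have hσ1 : 1 ≤ σ := by rw [hσ]; split_ifs <;> norm_num
  have hσ2 : σ ≤ 2 := by rw [hσ]; split_ifs <;> norm_num
  set s : Finset ℕ := (Finset.range (q * J)).filter q.Coprime with hs
  set I : ℕ → Set ℝ := fun b => Set.Ico (lam / q * ((σ * b : ℕ) : ℝ)) (lam / q * (((σ * b : ℕ) : ℝ) + 1))
    with hI
  have hsub : (⋃ b ∈ s, I b) ⊆ timeSet lam ρ q := by
    intro x hx
    simp only [Set.mem_iUnion] at hx
    obtain ⟨b, hb, hx1, hx2⟩ := hx
    rw [hs, Finset.mem_filter, Finset.mem_range] at hb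
    refine ⟨⟨le_trans (by positivity) hx1, lt_of_lt_of_le hx2 ?_⟩, (σ * b : ℕ), ?_, ?_, ?_⟩
    · have h1 : ((σ * b : ℕ) : ℝ) + 1 ≤ 2 * (q * J) := by
        have : σ * b + 1 ≤ 2 * (q * J) := by nlinarith
        exact_mod_cast this
      calc lam / q * (((σ * b : ℕ) : ℝ) + 1) ≤ lam / q * (2 * (q * J)) := by gcongr
        _ ≤ lam / q * (2 * (q * (ρ / lam / 2))) := by gcongr
        _ = ρ := by field_simp
    · have : Nat.Coprime (σ * b) q := by
        refine Nat.Coprime.mul_left ?_ hb.2.symm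
        rw [hσ]
        split_ifs with hodd
        · exact (Nat.coprime_two_left).2 hodd
        · simp
      have h := (ZMod.isUnit_iff_coprime (σ * b) q).2 this
      simpa using h
    · rw [hσ]
      split_ifs with hodd
      · push_cast
        exact (even_two.mul_right _).mul_right _
      · rw [Nat.not_odd_iff_even] at hodd
        have : Even (q : ℤ) := by exact_mod_cast hodd
        exact this.mul_left _
    · have e1 : ((σ * b : ℕ) : ℝ) / q ≤ x / lam := by
        rw [le_div_iff₀ hlam]
        calc _ = lam / q * ((σ * b : ℕ) : ℝ) := by ring
          _ ≤ x := hx1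
      have e2 : x / lam ≤ ((σ * b : ℕ) : ℝ) / q + 1 / q := by
        rw [div_le_iff₀ hlam]
        calc x ≤ _ := hx2.le
          _ = _ := by ring
      rw [abs_le, Int.cast_natCast]
      have : 0 ≤ 1 / (q : ℝ) := by positivity
      constructor <;> linarith
  have hdisj : Set.PairwiseDisjoint (s : Set ℕ) I := by
    have aux : ∀ b b' : ℕ, b < b' → Disjoint (I b) (I b') := by
      intro b b' hbb
      rw [Set.disjoint_left]
      rintro x ⟨_, hx2⟩ ⟨hx3, _⟩
      have : ((σ * b : ℕ) : ℝ) + 1 ≤ ((σ * b' : ℕ) : ℝ) := by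
        have : σ * b + 1 ≤ σ * b' := by nlinarith
        exact_mod_cast this
      have h2 : lam / q * (((σ * b : ℕ) : ℝ) + 1) ≤ lam / q * ((σ * b' : ℕ) : ℝ) := by gcongr
      linarith
    intro b _ b' _ hne
    rcases lt_or_gt_of_ne hne with h | h
    · exact aux b b' h
    · exact (aux b' b h).symm
  calc ENNReal.ofReal (η * ρ / 4) ≤ ENNReal.ofReal (s.card * (lam / q)) := by
        refine ENNReal.ofReal_le_ofReal ?_
        rw [hs, card_filter_coprime_range_mul]
        push_cast
        calc η * ρ / 4 = (ρ / lam / 4) * (η * q) * (lam / q) := by field_simp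
          _ ≤ J * q.totient * (lam / q) := by gcongr
    _ = ∑ b ∈ s, volume (I b) := by
        have : ∀ b, volume (I b) = ENNReal.ofReal (lam / q) := by
          intro b
          rw [hI, Real.volume_Ico]; congr 1; ring
        simp only [this]
        rw [Finset.sum_const, nsmul_eq_mul, ENNReal.ofReal_mul (by positivity)]
        simp
    _ = volume (⋃ b ∈ s, I b) := (measure_biUnion_finset hdisj fun b _ => measurableSet_Ico).symm
    _ ≤ _ := measure_mono hsub

/-- Fubini lower bound for a union of products. -/
theorem mul_le_volume_iUnion_prod {k : ℕ} (s : Finset ℕ) {S : ℕ → Set ℝ} {Y : ℕ → Set (Fin k → ℝ)}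
    (hS : ∀ q, MeasurableSet (S q)) (hY : ∀ q, MeasurableSet (Y q)) {κ : ENNReal}
    (hκ : ∀ q ∈ s, κ ≤ volume (S q)) :
    κ * volume (⋃ q ∈ s, Y q) ≤
      volume {x : Fin (k + 1) → ℝ | ∃ q ∈ s, x 0 ∈ S q ∧ (fun j : Fin k => x j.succ) ∈ Y q} := by
  set A : Set (ℝ × (Fin k → ℝ)) := ⋃ q ∈ s, S q ×ˢ Y q with hA
  have hAm : MeasurableSet A := Finset.measurableSet_biUnion _ fun q _ => (hS q).prod (hY q)
  have hpre : {x : Fin (k + 1) → ℝ | ∃ q ∈ s, x 0 ∈ S q ∧ (fun j : Fin k => x j.succ) ∈ Y q} =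
      MeasurableEquiv.piFinSuccAbove (fun _ : Fin (k + 1) => ℝ) 0 ⁻¹' A := by
    ext x
    simp only [hA, Set.mem_ofPred_eq, Set.mem_preimage, Set.mem_iUnion, Set.mem_prod, exists_prop]
    rfl
  have hU : MeasurableSet (⋃ q ∈ s, Y q) := Finset.measurableSet_biUnion _ fun q _ => hY q
  rw [hpre, (volume_preserving_piFinSuccAbove (fun _ : Fin (k + 1) => ℝ) 0).measure_preimage
    hAm.nullMeasurableSet, Measure.volume_eq_prod, Measure.prod_apply_symm hAm,
    ← setLIntegral_const]
  refine (setLIntegral_mono' hU fun y hy => ?_).trans (setLIntegral_le_lintegral _ _)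
  simp only [Set.mem_iUnion] at hy
  obtain ⟨q, hq, hyq⟩ := hy
  refine (hκ q hq).trans (measure_mono fun x hx => ?_)
  simp only [hA, Set.mem_preimage, Set.mem_iUnion, Set.mem_prod]
  exact ⟨q, hq, hx, hyq⟩

theorem prod_fin_ite {M : Type*} [CommMonoid M] {k d : ℕ} (hd : d ≤ k) (a b : M) :
    ∏ j : Fin k, (if (j : ℕ) < d then a else b) = a ^ d * b ^ (k - d) := by
  rw [Fin.prod_univ_eq_prod_range (fun j => if j < d then a else b) k, Finset.prod_ite,
    Finset.prod_const, Finset.prod_const]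
  have h1 : (Finset.range k).filter (· < d) = Finset.range d := by
    ext x; simp; omega
  have h2 : (Finset.range k).filter (fun x => ¬ x < d) = Finset.Ico d k := by
    ext x; simp; omega
  rw [h1, h2]; simp

/-- Denominators at scale `Q` having a positive proportion of admissible numerators. -/
noncomputable def goodDenoms (Q : ℕ) (ε : ℝ) : Finset ℕ :=
  (Finset.Ioc 0 Q).filter fun q => ε * Q ≤ q ∧ primeFactorsRecip q ≤ 1 / ε

/-- At most εQ denominators are too small, and by Markov's inequality at most εQ have too large a
sum of prime reciprocals. -/
theorem card_not_goodDenoms_le (Q : ℕ) {ε : ℝ} (hε : 0 < ε) :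
    ((Finset.Ioc 0 Q \ goodDenoms Q ε).card : ℝ) ≤ 2 * ε * Q := by
  have hsub : Finset.Ioc 0 Q \ goodDenoms Q ε ⊆ Finset.Ioc 0 ⌊ε * Q⌋₊ ∪
      (Finset.Ioc 0 Q).filter fun q => 1 / ε < primeFactorsRecip q := by
    intro q hq
    simp only [goodDenoms, Finset.mem_sdiff, Finset.mem_filter, not_and, not_le] at hq
    simp only [Finset.mem_union, Finset.mem_filter]
    by_cases h : ε * Q ≤ q
    · exact Or.inr ⟨hq.1, hq.2 hq.1 h⟩
    · refine Or.inl (Finset.mem_Ioc.2 ⟨(Finset.mem_Ioc.1 hq.1).1, Nat.le_floor (not_le.1 h).le⟩)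
  have h1 : ((Finset.Ioc 0 Q \ goodDenoms Q ε).card : ℝ) ≤ ((Finset.Ioc 0 ⌊ε * Q⌋₊).card : ℝ) +
      (((Finset.Ioc 0 Q).filter fun q => 1 / ε < primeFactorsRecip q).card : ℝ) := by
    exact_mod_cast (Finset.card_le_card hsub).trans (Finset.card_union_le _ _)
  have h2 := card_primeFactorsRecip_gt_le Q (K := 1 / ε) (by positivity)
  have h3 : ((Finset.Ioc 0 ⌊ε * Q⌋₊).card : ℝ) ≤ ε * Q := by
    rw [Nat.card_Ioc, Nat.sub_zero]; exact Nat.floor_le (by positivity)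
  have h4 : (Q : ℝ) / (1 / ε) = ε * Q := by field_simp
  linarith

/-- The spatial part of the exceptional set with denominator `q`. -/
def spaceSet (k d : ℕ) (D ρ ρ' : ℝ) (P q : ℕ) : Set (Fin k → ℝ) :=
  Set.univ.pi fun j => if (j : ℕ) < d then approxSet D ρ P q else Set.Ico 0 ρ'

theorem measurableSet_spaceSet (k d : ℕ) (D ρ ρ' : ℝ) (P q : ℕ) :
    MeasurableSet (spaceSet k d D ρ ρ' P q) := by
  refine MeasurableSet.univ_pi fun j => ?_
  split_ifs
  · exact measurableSet_approxSet _ _ _ _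
  · exact measurableSet_Ico

/-- Good denominators capture half of the box. -/
theorem half_le_volume_iUnion_spaceSet {k d : ℕ} (hd : d ≤ k) {D ρ ρ' : ℝ} (hρ0 : 0 ≤ ρ)
    (hρ' : 0 ≤ ρ') (hD : 0 < D) (hρ : 1 ≤ ρ * D / (2 * Real.pi)) {P : ℕ} (hP : 0 < P) :
    ENNReal.ofReal (ρ ^ d * ρ' ^ (k - d) / 2) ≤
      volume (⋃ q ∈ goodDenoms (P ^ d) (1 / (4 * 8 ^ d)), spaceSet k d D ρ ρ' P q) := by
  set ε : ℝ := 1 / (4 * 8 ^ d) with hε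
  set Q : ℕ := P ^ d with hQ
  set V : ℝ := ρ ^ d * ρ' ^ (k - d) with hV
  have hV0 : 0 ≤ V := by positivity
  have hP0 : (0 : ℝ) < P := Nat.cast_pos.2 hP
  set B : Set (Fin k → ℝ) := Set.univ.pi fun j => if (j : ℕ) < d then Set.Ico 0 ρ else Set.Ico 0 ρ'
    with hB
  have hBvol : volume B = ENNReal.ofReal V := by
    rw [hB, volume_pi_pi]
    have : ∀ j : Fin k, volume (if (j : ℕ) < d then Set.Ico 0 ρ else Set.Ico 0 ρ') =
        if (j : ℕ) < d then ENNReal.ofReal ρ else ENNReal.ofReal ρ' := by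
      intro j; split_ifs <;> simp
    simp only [this]
    rw [prod_fin_ite hd, hV, ENNReal.ofReal_mul (by positivity), ENNReal.ofReal_pow hρ0,
      ENNReal.ofReal_pow hρ']
  have hYvol : ∀ q, 0 < q → volume (spaceSet k d D ρ ρ' P q) ≤
      ENNReal.ofReal (8 ^ d / Q * V) := by
    intro q hq
    rw [spaceSet, volume_pi_pi]
    calc _ ≤ ∏ j : Fin k, (if (j : ℕ) < d then ENNReal.ofReal (8 / P * ρ) else
            ENNReal.ofReal ρ') := by
          refine Finset.prod_le_prod' fun j _ => ?_
          split_ifs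
          · exact volume_approxSet_le hD hρ hP hq
          · simp
      _ = ENNReal.ofReal (8 ^ d / Q * V) := by
          rw [prod_fin_ite hd, ← ENNReal.ofReal_pow (by positivity), ← ENNReal.ofReal_pow hρ',
            ← ENNReal.ofReal_mul (by positivity)]
          congr 1
          rw [hV, hQ, mul_pow, div_pow]; push_cast; ring
  have hcover : B ⊆ (⋃ q ∈ goodDenoms Q ε, spaceSet k d D ρ ρ' P q) ∪
      ⋃ q ∈ Finset.Ioc 0 Q \ goodDenoms Q ε, spaceSet k d D ρ ρ' P q := by
    intro y hy
    obtain ⟨q, hq1, hqQ, c, hc⟩ := exists_simultaneous_approx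
      (fun j : Fin d => D * y (Fin.castLE hd j) / (2 * Real.pi)) hP
    rw [Fintype.card_fin] at hqQ
    have hyq : y ∈ spaceSet k d D ρ ρ' P q := by
      intro j _
      have hyj := hy j (Set.mem_univ j)
      by_cases hj : (j : ℕ) < d
      · simp only [hj, if_true] at hyj ⊢
        exact ⟨hyj, c ⟨j, hj⟩, hc ⟨j, hj⟩⟩
      · simpa only [hj, if_false] using hyj
    by_cases hg : q ∈ goodDenoms Q ε
    · exact Or.inl (Set.mem_biUnion hg hyq)
    · refine Or.inr (Set.mem_biUnion (x := q) ?_ hyq)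
      simp only [Finset.coe_sdiff, Set.mem_sdiff, Finset.mem_coe, Finset.mem_Ioc]
      exact ⟨⟨hq1, hqQ⟩, hg⟩
  have hbad : volume (⋃ q ∈ Finset.Ioc 0 Q \ goodDenoms Q ε, spaceSet k d D ρ ρ' P q) ≤
      ENNReal.ofReal (V / 2) := by
    calc _ ≤ ∑ q ∈ Finset.Ioc 0 Q \ goodDenoms Q ε, volume (spaceSet k d D ρ ρ' P q) :=
          measure_biUnion_finset_le _ _
      _ ≤ ∑ q ∈ Finset.Ioc 0 Q \ goodDenoms Q ε, ENNReal.ofReal (8 ^ d / Q * V) :=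
          Finset.sum_le_sum fun q hq => hYvol q
            (Finset.mem_Ioc.1 (Finset.mem_sdiff.1 hq).1).1
      _ = ENNReal.ofReal ((Finset.Ioc 0 Q \ goodDenoms Q ε).card * (8 ^ d / Q * V)) := by
          rw [Finset.sum_const, nsmul_eq_mul, ENNReal.ofReal_mul (Nat.cast_nonneg _),
            ENNReal.ofReal_natCast]
      _ ≤ ENNReal.ofReal (V / 2) := by
          refine ENNReal.ofReal_le_ofReal ?_
          have hQ0 : (0 : ℝ) < Q := by rw [hQ]; positivity
          calc _ ≤ (2 * ε * Q) * (8 ^ d / Q * V) := by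
                gcongr
                exact card_not_goodDenoms_le Q (by positivity)
            _ = V / 2 := by rw [hε]; field_simp; norm_num
  have hfinal : ENNReal.ofReal V ≤
      volume (⋃ q ∈ goodDenoms Q ε, spaceSet k d D ρ ρ' P q) + ENNReal.ofReal (V / 2) := by
    rw [← hBvol]
    exact (measure_mono hcover).trans ((measure_union_le _ _).trans (by gcongr))
  have : ENNReal.ofReal (V / 2) = ENNReal.ofReal V - ENNReal.ofReal (V / 2) := by
    rw [← ENNReal.ofReal_sub _ (by positivity)]; congr 1; ring
  rw [this]
  exact tsub_le_iff_right.2 hfinal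

/-! ### The datum and the lower bound for its evolution. -/

theorem integral_norm_sq_pos_of_integral_ne_zero {F : ℝ → ℂ} (hF : MemLp F 2 volume) {e : ℝ → ℂ}
    (h : ∫ s, e s * F s ≠ 0) : 0 < ∫ s, ‖F s‖ ^ 2 := by
  refine lt_of_le_of_ne (integral_nonneg fun s => by positivity) fun h0 => h ?_
  have h1 := (integral_eq_zero_iff_of_nonneg (fun s => by positivity)
    ((memLp_two_iff_integrable_sq_norm hF.aestronglyMeasurable).1 hF)).1 h0.symm
  refine integral_eq_zero_of_ae ?_
  filter_upwards [h1] with s hs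
  have : F s = 0 := by simpa using hs
  simp [this]

/-- Nonvanishing of the one-dimensional integrals forces ‖f‖ > 0, so the quotient of products can be
bounded factor by factor. -/
theorem le_norm_schrodinger_div_norm {n : ℕ} {F : Fin n → ℝ → ℂ} (hF : ∀ j, MemLp (F j) 2 volume)
    {f : Lp (α := EuclideanSpace ℝ (Fin n)) ℂ 2 volume} {t : ℝ} {x : EuclideanSpace ℝ (Fin n)}
    (hf : ‖f‖ ^ 2 = ∏ j, ∫ s, ‖F j s‖ ^ 2)
    (hs : schrodinger t f x = (((2 * Real.pi) ^ (-(n : ℝ) / 2) : ℝ) : ℂ) *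
        ∏ j, ∫ s, Complex.exp (Complex.I * ((x j * s + t * s ^ 2 : ℝ) : ℂ)) * F j s)
    {r : Fin n → ℝ} (hr : ∀ j, 0 ≤ r j)
    (hpos : ∀ j, 0 < ‖∫ s, Complex.exp (Complex.I * ((x j * s + t * s ^ 2 : ℝ) : ℂ)) * F j s‖)
    (hle : ∀ j, r j * √(∫ s, ‖F j s‖ ^ 2) ≤
      ‖∫ s, Complex.exp (Complex.I * ((x j * s + t * s ^ 2 : ℝ) : ℂ)) * F j s‖) :
    (2 * Real.pi) ^ (-(n : ℝ) / 2) * ∏ j, r j ≤ ‖schrodinger t f x‖ / ‖f‖ := by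
  have hb : ∀ j, 0 < ∫ s, ‖F j s‖ ^ 2 := fun j =>
    integral_norm_sq_pos_of_integral_ne_zero (hF j) (norm_pos_iff.1 (hpos j))
  have hfn : ‖f‖ = ∏ j, √(∫ s, ‖F j s‖ ^ 2) := by
    rw [← Real.sqrt_sq (norm_nonneg f), hf, Real.sqrt_prod _ fun j _ => (hb j).le]
  have hf0 : 0 < ‖f‖ := by
    rw [hfn]; exact Finset.prod_pos fun j _ => Real.sqrt_pos.2 (hb j)
  rw [le_div_iff₀ hf0, hs, norm_mul, Complex.norm_real, Real.norm_of_nonneg (by positivity),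
    norm_prod, mul_assoc, hfn, ← Finset.prod_mul_distrib]
  gcongr with j
  · exact fun j _ => mul_nonneg (hr j) (Real.sqrt_nonneg _)
  · exact hle j

/-- The Fourier factors of the datum. -/
noncomputable def datumFactor {k : ℕ} (d : ℕ) (R D : ℝ) (M : ℕ) : Fin (k + 1) → ℝ → ℂ :=
  Fin.cons (bump R √R) fun j : Fin k => if (j : ℕ) < d then fejerBump M D else bump 0 √R

theorem memLp_datumFactor {k : ℕ} (d : ℕ) (R D : ℝ) (M : ℕ) (j : Fin (k + 1)) :
    MemLp (datumFactor d R D M j) 2 volume := by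
  refine Fin.cases ?_ (fun j => ?_) j
  · exact memLp_bump _ _ _
  · simp only [datumFactor, Fin.cons_succ]
    split_ifs
    · exact memLp_fejerBump _ _ _
    · exact memLp_bump _ _ _

theorem mem_Ioc_of_bump_ne_zero {b w s : ℝ} (h : bump b w s ≠ 0) : s ∈ Set.Ioc b (b + w) :=
  Set.mem_of_indicator_ne_zero h

theorem abs_le_of_fejerBump_ne_zero {M : ℕ} {D s : ℝ} (hD : 0 ≤ D) (h : fejerBump M D s ≠ 0) :
    |s| ≤ D * M + 1 := by
  obtain ⟨k, hk, hk'⟩ := Finset.exists_ne_zero_of_sum_ne_zero h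
  obtain ⟨l, hl, hl'⟩ := Finset.exists_ne_zero_of_sum_ne_zero hk'
  have hs := mem_Ioc_of_bump_ne_zero hl'
  have hkM : (k : ℝ) ≤ M := by exact_mod_cast (Finset.mem_range.1 hk).le
  have hlM : (l : ℝ) ≤ M := by exact_mod_cast (Finset.mem_range.1 hl).le
  have hk0 : (0 : ℝ) ≤ k := Nat.cast_nonneg k
  have hl0 : (0 : ℝ) ≤ l := Nat.cast_nonneg l
  have h1 : D * ((k : ℝ) - l) ≤ D * M := by gcongr; linarith
  have h2 : D * (-M) ≤ D * ((k : ℝ) - l) := by gcongr; linarith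
  rw [abs_le]
  constructor <;> linarith [hs.1, hs.2]

theorem norm_le_sum_abs {n : ℕ} (x : EuclideanSpace ℝ (Fin n)) : ‖x‖ ≤ ∑ j, |x j| := by
  rw [EuclideanSpace.norm_eq]
  refine Real.sqrt_le_iff.2 ⟨Finset.sum_nonneg fun _ _ => abs_nonneg _, ?_⟩
  simp only [Real.norm_eq_abs]
  exact Finset.sum_sq_le_sq_sum_of_nonneg fun _ _ => abs_nonneg _

/-- The first coordinate exceeds R on the support, and every coordinate is at most 2R in modulus: R
+ √R for the first, DM + 1 for the middle ones, √R for the last. -/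
theorem datumFactor_prod_eq_zero {k d : ℕ} {R D : ℝ} {M : ℕ} (hR : 1 < R) (hD : 0 ≤ D)
    (hDM : D * M ≤ R) {ξ : EuclideanSpace ℝ (Fin (k + 1))}
    (hξ : ¬ (R ≤ ‖ξ‖ ∧ ‖ξ‖ ≤ 2 * (k + 1) * R)) :
    ∏ j, datumFactor d R D M j (ξ j) = 0 := by
  by_contra hne
  rw [← ne_eq, Finset.prod_ne_zero_iff] at hne
  have hsqrt : √R ≤ R := by
    rw [Real.sqrt_le_left (by linarith)]; nlinarith
  have hR0 : 0 ≤ √R := Real.sqrt_nonneg R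
  have h0 := mem_Ioc_of_bump_ne_zero (hne 0 (Finset.mem_univ _))
  have hj : ∀ j : Fin (k + 1), |ξ j| ≤ 2 * R := by
    refine Fin.cases ?_ fun j => ?_
    · rw [abs_le]; constructor <;> linarith [h0.1, h0.2]
    · have h := hne j.succ (Finset.mem_univ _)
      simp only [datumFactor, Fin.cons_succ] at h
      split_ifs at h
      · linarith [abs_le_of_fejerBump_ne_zero hD h]
      · have := mem_Ioc_of_bump_ne_zero h
        rw [abs_le]; constructor <;> linarith [this.1, this.2]
  refine hξ ⟨?_, ?_⟩
  · calc R ≤ |ξ 0| := h0.1.le.trans (le_abs_self _)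
      _ ≤ ‖ξ‖ := by simpa using PiLp.norm_apply_le ξ 0
  · refine (norm_le_sum_abs ξ).trans ((Finset.sum_le_sum fun j _ => hj j).trans_eq ?_)
    simp; ring

/-- A datum at frequency scale `R`, with a lower bound for its evolution wherever the middle
factors are known to be large. -/
theorem exists_datum {k d : ℕ} (hd : d ≤ k) {R D : ℝ} {M : ℕ} (hR : 1 < R) (hD : 1 ≤ D)
    (hDM : D * M ≤ R) :
    ∃ f : Lp (α := EuclideanSpace ℝ (Fin (k + 1))) ℂ 2 volume,
      (∀ᵐ ξ : EuclideanSpace ℝ (Fin (k + 1)),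
        ¬ (R ≤ ‖ξ‖ ∧ ‖ξ‖ ≤ 2 * (k + 1) * R) → unitaryFourier f ξ = 0) ∧
      ∀ (t A : ℝ) (x : EuclideanSpace ℝ (Fin (k + 1))), 0 < A → 0 < M →
        √R * |x 0 + 2 * t * R| ≤ 1 / 4 → |t| * R ≤ 1 / 4 →
        (∀ j : Fin k, ¬ (j : ℕ) < d → √R * |x j.succ| ≤ 1 / 4) →
        (∀ j : Fin k, (j : ℕ) < d → A * √((M : ℝ) ^ 3) ≤
          ‖∫ s, Complex.exp (Complex.I * ((x j.succ * s + t * s ^ 2 : ℝ) : ℂ)) *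
            fejerBump M D s‖) →
        (2 * Real.pi) ^ (-((k + 1 : ℕ) : ℝ) / 2) * ((1 / 2) ^ (k + 1) *
          (√√R * (A ^ d * (√√R) ^ (k - d)))) ≤ ‖schrodinger t f x‖ / ‖f‖ := by
  obtain ⟨f, hf, hfn, hfs⟩ := exists_tensor_datum (datumFactor (k := k) d R D M)
    (memLp_datumFactor d R D M)
  refine ⟨f, ?_, fun t A x hA hM h0 ht htail hmid => ?_⟩
  · filter_upwards [hf] with ξ hξ hno
    rw [hξ]
    exact datumFactor_prod_eq_zero hR (by linarith) hDM hno
  have hR0 : 0 < R := by linarith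
  have hsR : 0 < √R := Real.sqrt_pos.2 hR0
  have hsR2 : √R ^ 2 = R := Real.sq_sqrt hR0.le
  have hssR : √√R * √√R = √R := Real.mul_self_sqrt hsR.le
  have hssR0 : 0 < √√R := Real.sqrt_pos.2 hsR
  have hb0 : √R / 2 ≤ ‖∫ s, Complex.exp (Complex.I * ((x 0 * s + t * s ^ 2 : ℝ) : ℂ)) *
      bump R √R s‖ := half_le_norm_integral_bump hsR.le (by rw [hsR2]; linarith)
  have hbt : ∀ j : Fin k, ¬ (j : ℕ) < d → √R / 2 ≤
      ‖∫ s, Complex.exp (Complex.I * ((x j.succ * s + t * s ^ 2 : ℝ) : ℂ)) * bump 0 √R s‖ :=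
    fun j hj => half_le_norm_integral_bump hsR.le (by
      rw [hsR2, mul_zero, add_zero]; linarith [htail j hj])
  have hM3 : 0 < √((M : ℝ) ^ 3) := Real.sqrt_pos.2 (by positivity)
  have key := le_norm_schrodinger_div_norm (memLp_datumFactor d R D M) hfn (hfs t x)
    (r := Fin.cons (√√R / 2) fun j : Fin k => if (j : ℕ) < d then A else √√R / 2)
    (by
      refine Fin.cases ?_ fun j => ?_
      · simp only [Fin.cons_zero]; positivity
      · simp only [Fin.cons_succ]; split_ifs <;> positivity)
    (by
      refine Fin.cases ?_ fun j => ?_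
      · exact lt_of_lt_of_le (by positivity) hb0
      · simp only [datumFactor, Fin.cons_succ]
        split_ifs with hj
        · exact lt_of_lt_of_le (by positivity) (hmid j hj)
        · exact lt_of_lt_of_le (by positivity) (hbt j hj))
    (by
      refine Fin.cases ?_ fun j => ?_
      · simp only [datumFactor, Fin.cons_zero]
        rw [integral_norm_sq_bump R hsR.le]
        exact le_trans (le_of_eq (by rw [← hssR, Real.sqrt_mul_self hssR0.le]; ring)) hb0
      · simp only [datumFactor, Fin.cons_succ]
        split_ifs with hj
        · refine le_trans ?_ (hmid j hj)
          gcongr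
          exact integral_norm_sq_fejerBump_le M hD
        · rw [integral_norm_sq_bump 0 hsR.le]
          exact le_trans (le_of_eq (by rw [← hssR, Real.sqrt_mul_self hssR0.le]; ring)) (hbt j hj))
  refine le_trans ?_ key
  gcongr
  rw [Fin.prod_univ_succ]
  simp only [Fin.cons_zero, Fin.cons_succ]
  rw [prod_fin_ite hd]
  -- Only the 1 + k - d plain bumps bring a factor 1/2; a further 2^{-d} is given away to get a
  -- constant independent of d.
  have h1 : (1 / 2 : ℝ) ^ (k + 1) * (√√R * (A ^ d * (√√R) ^ (k - d))) =
      (1 / 2) ^ d * (√√R / 2 * (A ^ d * (√√R / 2) ^ (k - d))) := by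
    obtain ⟨e, rfl⟩ := Nat.exists_eq_add_of_le hd
    rw [Nat.add_sub_cancel_left]
    simp only [div_eq_mul_inv, one_mul, mul_pow]
    ring
  rw [h1]
  refine mul_le_of_le_one_left (by positivity) (pow_le_one₀ (by norm_num) (by norm_num))

/-! ### The exceptional set and its times. -/

/-- The box containing the exceptional set. -/
def spaceBox (k d : ℕ) (ρ R : ℝ) : Set (Fin (k + 1) → ℝ) :=
  Set.univ.pi fun j => if (j : ℕ) < d + 1 then Set.Ico 0 ρ else Set.Ico 0 (ρ / √R)

theorem measurableSet_spaceBox (k d : ℕ) (ρ R : ℝ) : MeasurableSet (spaceBox k d ρ R) := by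
  refine MeasurableSet.univ_pi fun j => ?_
  split_ifs <;> exact measurableSet_Ico

theorem volume_spaceBox {k d : ℕ} (hd : d ≤ k) {ρ : ℝ} (hρ : 0 ≤ ρ) (R : ℝ) :
    volume (spaceBox k d ρ R) = ENNReal.ofReal (ρ ^ (k + 1) * (1 / √R) ^ (k - d)) := by
  rw [spaceBox, volume_pi_pi]
  have : ∀ j : Fin (k + 1), volume (if (j : ℕ) < d + 1 then Set.Ico 0 ρ else Set.Ico 0 (ρ / √R)) =
      if (j : ℕ) < d + 1 then ENNReal.ofReal ρ else ENNReal.ofReal (ρ / √R) := by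
    intro j; split_ifs <;> simp
  simp only [this]
  rw [prod_fin_ite (by omega), ← ENNReal.ofReal_pow hρ, ← ENNReal.ofReal_pow (by positivity),
    ← ENNReal.ofReal_mul (by positivity)]
  congr 1
  obtain ⟨e, rfl⟩ := Nat.exists_eq_add_of_le hd
  have h1 : d + e + 1 - (d + 1) = e := by omega
  rw [h1, Nat.add_sub_cancel_left]
  simp only [div_eq_mul_inv, one_mul, mul_pow]
  ring

theorem mem_Ico_of_mem_spaceBox {k d : ℕ} {ρ R : ℝ} (hρ : 0 ≤ ρ) (hR : 1 ≤ R)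
    {x : Fin (k + 1) → ℝ} (hx : x ∈ spaceBox k d ρ R) (j : Fin (k + 1)) : x j ∈ Set.Ico 0 ρ := by
  have h := hx j (Set.mem_univ j)
  have h1 : ρ / √R ≤ ρ := div_le_self hρ (Real.one_le_sqrt.2 hR)
  dsimp only at h
  split_ifs at h
  · exact h
  · exact ⟨h.1, lt_of_lt_of_le h.2 h1⟩

/-- Reduction to a set of points at which the middle factors are large. -/
theorem exists_datum_of_largeSet {k d : ℕ} (hd : d ≤ k) {R D A C v a ρ : ℝ} {M : ℕ} (hR : 1 < R)
    (hD : 1 ≤ D) (hDM : D * M ≤ R) (hM : 0 < M) (hA : 0 < A)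
    (hρ0 : 0 < ρ) (hρ : 8 * (k + 1) * ρ ≤ 1) (hv : 0 < v)
    {S : Set (Fin (k + 1) → ℝ)} (hSm : MeasurableSet S) (hSB : S ⊆ spaceBox k d ρ R)
    (hSv : ENNReal.ofReal (v * (1 / √R) ^ (k - d)) ≤ volume S)
    (ha : a * R ^ (((d : ℝ) + 1) / (2 * (d + 2))) ≤ √√R * A ^ d)
    (hC1 : 2 * (k + 1) ≤ C) (hC2 : C⁻¹ ≤ v)
    (hC3 : C⁻¹ ≤ (2 * Real.pi) ^ (-((k + 1 : ℕ) : ℝ) / 2) * (1 / 2) ^ (k + 1) * a)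
    (hS : ∀ x ∈ S, ∃ t : ℝ, √R * |x 0 + 2 * t * R| ≤ 1 / 8 ∧
      ∀ j : Fin k, (j : ℕ) < d → A * √((M : ℝ) ^ 3) ≤
        ‖∫ s, Complex.exp (Complex.I * ((x j.succ * s + t * s ^ 2 : ℝ) : ℂ)) * fejerBump M D s‖) :
    ∃ f : Lp (α := EuclideanSpace ℝ (Fin (k + 1))) ℂ 2 volume,
      f ≠ 0 ∧
      (∀ᵐ ξ : EuclideanSpace ℝ (Fin (k + 1)),
        ¬ (C⁻¹ * R ≤ ‖ξ‖ ∧ ‖ξ‖ ≤ C * R) → unitaryFourier f ξ = 0) ∧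
      ∃ E : Set (EuclideanSpace ℝ (Fin (k + 1))),
        MeasurableSet E ∧ E ⊆ Metric.ball 0 1 ∧
        C⁻¹ * R ^ (-(((k + 1 : ℕ) : ℝ) - ((d + 1 : ℕ) : ℝ)) / 2) ≤ volume.real E ∧
        volume.real E ≤ C * R ^ (-(((k + 1 : ℕ) : ℝ) - ((d + 1 : ℕ) : ℝ)) / 2) ∧
        ∀ x ∈ E, ∃ t : ℝ,
          |t - (-(x 0) / (2 * R))| ≤ C * R ^ (-(3 : ℝ) / 2) ∧
          C⁻¹ * (R ^ (((d + 1 : ℕ) : ℝ) / (2 * (((d + 1 : ℕ) : ℝ) + 1))) *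
            R ^ ((((k + 1 : ℕ) : ℝ) - ((d + 1 : ℕ) : ℝ)) / 4)) ≤ ‖schrodinger t f x‖ / ‖f‖ := by
  have hR0 : 0 < R := by linarith
  have hk0 : (0 : ℝ) ≤ k := Nat.cast_nonneg k
  have hsR : 0 < √R := Real.sqrt_pos.2 hR0
  have hsR1 : 1 ≤ √R := Real.one_le_sqrt.2 hR.le
  have hC1' : 1 ≤ C := by linarith
  have hC0 : 0 < C := by linarith
  have hρ8 : ρ ≤ 1 / 8 := by nlinarith
  have hρ1 : ρ ≤ 1 := by linarith
  have hsub : ((k - d : ℕ) : ℝ) = ((k + 1 : ℕ) : ℝ) - ((d + 1 : ℕ) : ℝ) := by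
    rw [Nat.cast_sub hd]; push_cast; ring
  have hpow2 : R ^ (-(((k + 1 : ℕ) : ℝ) - ((d + 1 : ℕ) : ℝ)) / 2) = (1 / √R) ^ (k - d) := by
    rw [← hsub, one_div, inv_pow, Real.sqrt_eq_rpow, ← Real.rpow_natCast, ← Real.rpow_mul hR0.le,
      ← Real.rpow_neg hR0.le]
    congr 1; ring
  have hpow4 : R ^ ((((k + 1 : ℕ) : ℝ) - ((d + 1 : ℕ) : ℝ)) / 4) = (√√R) ^ (k - d) := by
    rw [← hsub, Real.sqrt_eq_rpow, Real.sqrt_eq_rpow, ← Real.rpow_mul hR0.le, ← Real.rpow_natCast,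
      ← Real.rpow_mul hR0.le]
    congr 1; ring
  have hpow32 : R ^ (-(3 : ℝ) / 2) = 1 / (√R * R) := by
    have : √R * R = R ^ ((3 : ℝ) / 2) := by
      rw [Real.sqrt_eq_rpow, ← Real.rpow_add_one hR0.ne']; norm_num
    rw [this, one_div, ← Real.rpow_neg hR0.le]; norm_num
  have hpowm : R ^ (((d + 1 : ℕ) : ℝ) / (2 * (((d + 1 : ℕ) : ℝ) + 1))) =
      R ^ (((d : ℝ) + 1) / (2 * (d + 2))) := by
    congr 1; push_cast; ring
  obtain ⟨f, hsupp, hlow⟩ := exists_datum (d := d) hd hR hD hDM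
  have hmp := PiLp.volume_preserving_ofLp (Fin (k + 1))
  set E : Set (EuclideanSpace ℝ (Fin (k + 1))) := (fun x => x.ofLp) ⁻¹' S with hE
  have hEm : MeasurableSet E := hmp.measurable hSm
  have hEvol : volume E = volume S := hmp.measure_preimage hSm.nullMeasurableSet
  have hBfin : volume S ≤ ENNReal.ofReal (ρ ^ (k + 1) * (1 / √R) ^ (k - d)) :=
    (measure_mono hSB).trans_eq (volume_spaceBox hd hρ0.le R)
  have hEreal_le : volume.real E ≤ (1 / √R) ^ (k - d) := by
    rw [Measure.real, hEvol]
    refine (ENNReal.toReal_mono ENNReal.ofReal_ne_top hBfin).trans ?_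
    rw [ENNReal.toReal_ofReal (by positivity)]
    exact mul_le_of_le_one_left (by positivity) (pow_le_one₀ hρ0.le hρ1)
  have hEreal_ge : v * (1 / √R) ^ (k - d) ≤ volume.real E := by
    rw [Measure.real, hEvol, ← ENNReal.ofReal_le_iff_le_toReal
      (ne_top_of_le_ne_top ENNReal.ofReal_ne_top hBfin)]
    exact hSv
  have hmain : ∀ x ∈ E, ∃ t : ℝ,
      |t - (-(x 0) / (2 * R))| ≤ C * R ^ (-(3 : ℝ) / 2) ∧
      C⁻¹ * (R ^ (((d + 1 : ℕ) : ℝ) / (2 * (((d + 1 : ℕ) : ℝ) + 1))) *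
        R ^ ((((k + 1 : ℕ) : ℝ) - ((d + 1 : ℕ) : ℝ)) / 4)) ≤ ‖schrodinger t f x‖ / ‖f‖ := by
    intro x hx
    obtain ⟨t, ht, hmid⟩ := hS _ hx
    have hxB := hSB hx
    have hx0 := mem_Ico_of_mem_spaceBox hρ0.le hR.le hxB 0
    change x 0 ∈ Set.Ico 0 ρ at hx0
    change √R * |x 0 + 2 * t * R| ≤ 1 / 8 at ht
    refine ⟨t, ?_, ?_⟩
    -- The bound √R |x₀ + 2tR| ≤ 1/8 says that t is within R^{-3/2}/16 of -x₀/(2R).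
    · have h1 : t - (-(x 0) / (2 * R)) = (x 0 + 2 * t * R) / (2 * R) := by field_simp; ring
      rw [h1, hpow32, abs_div, abs_of_pos (by positivity : 0 < 2 * R)]
      have h2 : |x 0 + 2 * t * R| / (2 * R) = (√R * |x 0 + 2 * t * R|) / 2 * (1 / (√R * R)) := by
        field_simp
      rw [h2]
      gcongr
      linarith
    · have hxt : |x 0 + 2 * t * R| ≤ 1 / 8 := by
        refine le_trans ?_ ht
        exact le_mul_of_one_le_left (abs_nonneg _) hsR1
      have htR : |t| * R ≤ 1 / 4 := by
        have e1 : |t| * R = |t * R| := by rw [abs_mul, abs_of_pos hR0]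
        rw [abs_le] at hxt
        rw [e1, abs_le]
        constructor <;> linarith [hx0.1, hx0.2]
      have hlow' := hlow t A x hA hM (by linarith) htR (fun j hj => by
        have h := hxB j.succ (Set.mem_univ _)
        have hj' : ¬ ((j.succ : Fin (k + 1)) : ℕ) < d + 1 := by simpa using hj
        simp only [hj', if_false] at h
        rw [abs_of_nonneg h.1]
        calc √R * x j.succ ≤ √R * (ρ / √R) := by gcongr; exact h.2.le
          _ = ρ := by field_simp
          _ ≤ 1 / 4 := by linarith) hmid
      refine le_trans ?_ hlow'
      rw [hpow4, hpowm]
      set c := (2 * Real.pi) ^ (-((k + 1 : ℕ) : ℝ) / 2)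
      have hRp : 0 < R ^ (((d : ℝ) + 1) / (2 * (d + 2))) := by positivity
      calc C⁻¹ * (R ^ (((d : ℝ) + 1) / (2 * (d + 2))) * (√√R) ^ (k - d))
          ≤ (c * (1 / 2) ^ (k + 1) * a) * (R ^ (((d : ℝ) + 1) / (2 * (d + 2))) * (√√R) ^ (k - d)) := by
            gcongr
        _ = c * (1 / 2) ^ (k + 1) * (a * R ^ (((d : ℝ) + 1) / (2 * (d + 2)))) * (√√R) ^ (k - d) := by
            ring
        _ ≤ c * (1 / 2) ^ (k + 1) * (√√R * A ^ d) * (√√R) ^ (k - d) := by gcongr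
        _ = _ := by ring
  have hEne : E.Nonempty := by
    rw [Set.nonempty_iff_ne_empty]
    intro h0
    rw [h0, measureReal_empty] at hEreal_ge
    have : 0 < v * (1 / √R) ^ (k - d) := by positivity
    linarith
  refine ⟨f, ?_, ?_, E, hEm, ?_, ?_, ?_, hmain⟩
  -- At a point of the nonempty set E, f = 0 would make the quotient 0 by the convention for
  -- division by zero, against the positive lower bound.
  · rintro rfl
    obtain ⟨x, hx⟩ := hEne
    obtain ⟨t, _, ht⟩ := hmain x hx
    rw [norm_zero, div_zero] at ht
    exact absurd ht (not_le.2 (by positivity))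
  · filter_upwards [hsupp] with ξ hξ hno
    refine hξ fun h => hno ⟨le_trans ?_ h.1, h.2.trans ?_⟩
    · exact mul_le_of_le_one_left hR0.le (inv_le_one_of_one_le₀ hC1')
    · gcongr
  · intro x hx
    rw [mem_ball_zero_iff]
    refine (norm_le_sum_abs x).trans_lt ?_
    calc ∑ j, |x j| ≤ ∑ _j : Fin (k + 1), ρ := by
          refine Finset.sum_le_sum fun j _ => ?_
          have h := mem_Ico_of_mem_spaceBox hρ0.le hR.le (hSB hx) j
          rw [abs_of_nonneg h.1]; exact h.2.le
      _ = (k + 1) * ρ := by simp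
      _ < 1 := by nlinarith
  · rw [hpow2]
    refine le_trans ?_ hEreal_ge
    gcongr
  · rw [hpow2]
    exact hEreal_le.trans (le_mul_of_one_le_left (by positivity) hC1')

/-- Serves the bounded range of R: with M = D = 1 the Fejér sum is a single bump. -/
theorem half_le_norm_integral_fejerBump_one {x t : ℝ} (h : |x| + |t| ≤ 1 / 2) :
    1 / 2 ≤ ‖∫ s, Complex.exp (Complex.I * ((x * s + t * s ^ 2 : ℝ) : ℂ)) * fejerBump 1 1 s‖ := by
  have h1 : fejerBump 1 1 = bump 0 1 := by ext s; simp [fejerBump]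
  rw [h1]
  refine half_le_norm_integral_bump zero_le_one ?_
  simpa using h

/-- The exceptional set. -/
def largeSet (k d : ℕ) (R D ρ : ℝ) (P : ℕ) : Set (Fin (k + 1) → ℝ) :=
  {x | ∃ q ∈ goodDenoms (P ^ d) (1 / (4 * 8 ^ d)),
    x 0 ∈ timeSet (2 * Real.pi * R / D ^ 2) ρ q ∧
      (fun j : Fin k => x j.succ) ∈ spaceSet k d D ρ (ρ / √R) P q}

theorem measurableSet_largeSet (k d : ℕ) (R D ρ : ℝ) (P : ℕ) :
    MeasurableSet (largeSet k d R D ρ P) := by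
  have : largeSet k d R D ρ P = ⋃ q ∈ goodDenoms (P ^ d) (1 / (4 * 8 ^ d)),
      ((fun x : Fin (k + 1) → ℝ => x 0) ⁻¹' timeSet (2 * Real.pi * R / D ^ 2) ρ q) ∩
      ((fun x : Fin (k + 1) → ℝ => fun j : Fin k => x j.succ) ⁻¹'
        spaceSet k d D ρ (ρ / √R) P q) := by
    ext x
    simp only [largeSet, Set.mem_ofPred_eq, Set.mem_iUnion, Set.mem_inter_iff, Set.mem_preimage,
      exists_prop]
  rw [this]
  refine Finset.measurableSet_biUnion _ fun q _ => ?_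
  refine MeasurableSet.inter ?_ ?_
  · exact measurable_pi_apply 0 (measurableSet_timeSet _ _ _)
  · exact (measurable_pi_lambda _ fun j => measurable_pi_apply _) (measurableSet_spaceSet _ _ _ _ _ _ _)

theorem largeSet_subset_spaceBox (k d : ℕ) (R D ρ : ℝ) (P : ℕ) :
    largeSet k d R D ρ P ⊆ spaceBox k d ρ R := by
  rintro x ⟨q, -, hx0, hxs⟩
  intro j _
  refine Fin.cases ?_ (fun j => ?_) j
  · simpa using hx0.1
  · have h := hxs j (Set.mem_univ j)
    by_cases hj : (j : ℕ) < d
    · simp only [hj, if_true] at h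
      simpa [hj] using h.1
    · simp only [hj, if_false] at h
      simpa [hj] using h

/-- Good denominators satisfy φ(q)/q ≥ η = exp(-2 · 4 · 8^d). The slices in x₀ then have measure at
least ηρ/4 and the spatial sets fill half of their box, whence η/8. -/
theorem le_volume_largeSet {k d : ℕ} (hd : d ≤ k) {R D ρ : ℝ} {P : ℕ} (hR : 0 < R) (hD : 0 < D)
    (hP : 0 < P) (hρ0 : 0 ≤ ρ) (hlam : 2 * (2 * Real.pi * R / D ^ 2) ≤ ρ)
    (hρ : 1 ≤ ρ * D / (2 * Real.pi)) :
    ENNReal.ofReal (Real.exp (-2 * (4 * 8 ^ d)) * ρ ^ (k + 1) / 8 * (1 / √R) ^ (k - d)) ≤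
      volume (largeSet k d R D ρ P) := by
  have hpi := Real.pi_pos
  set η : ℝ := Real.exp (-2 * (4 * 8 ^ d)) with hη
  have h1 := mul_le_volume_iUnion_prod (goodDenoms (P ^ d) (1 / (4 * 8 ^ d)))
    (measurableSet_timeSet (2 * Real.pi * R / D ^ 2) ρ)
    (measurableSet_spaceSet k d D ρ (ρ / √R) P) (κ := ENNReal.ofReal (η * ρ / 4)) (by
      intro q hq
      simp only [goodDenoms, Finset.mem_filter, Finset.mem_Ioc, one_div_one_div] at hq
      refine le_volume_timeSet (by positivity) hlam hq.1.1 ?_ (Real.exp_nonneg _)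
      refine le_trans ?_ (exp_mul_le_totient q)
      rw [hη]
      gcongr ?_ * _
      refine Real.exp_le_exp.2 ?_
      linarith [hq.2.2])
  refine le_trans ?_ h1
  have h2 := half_le_volume_iUnion_spaceSet hd hρ0 (by positivity : 0 ≤ ρ / √R) hD hρ hP
  refine le_trans ?_ (mul_le_mul_right h2 _)
  rw [← ENNReal.ofReal_mul (by positivity)]
  refine ENNReal.ofReal_le_ofReal (le_of_eq ?_)
  obtain ⟨e, rfl⟩ := Nat.exists_eq_add_of_le hd
  rw [Nat.add_sub_cancel_left]
  simp only [div_eq_mul_inv, one_mul, mul_pow]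
  ring

/-- The fraction a/q near x₀/lam determines t. Since q is common to all the middle coordinates, this
single t makes all the middle factors large at once. -/
theorem exists_time_of_mem_largeSet {k d : ℕ} {R D ρ : ℝ} {P M : ℕ} (hR : 1 < R) (hD : 0 < D)
    (hP : 0 < P) (hρ : ρ ≤ 1 / 8)
    (hlam : √R * (2 * Real.pi * R / D ^ 2) ≤ 1 / (4 * 8 ^ d) * (P : ℝ) ^ d / 8)
    (hPM : 16 * P ^ d ≤ M) (hDM : D * M ≤ R / 32)
    (hMP : 2 * Real.pi * M ≤ 1 / (4 * 8 ^ d) * (P : ℝ) ^ d * P / 128)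
    {x : Fin (k + 1) → ℝ} (hx : x ∈ largeSet k d R D ρ P) :
    ∃ t : ℝ, √R * |x 0 + 2 * t * R| ≤ 1 / 8 ∧
      ∀ j : Fin k, (j : ℕ) < d → (√(M / (P : ℝ) ^ d) / 2) * √((M : ℝ) ^ 3) ≤
        ‖∫ s, Complex.exp (Complex.I * ((x j.succ * s + t * s ^ 2 : ℝ) : ℂ)) *
          fejerBump M D s‖ := by
  have hpi := Real.pi_pos
  have hR0 : 0 < R := by linarith
  have hsR1 : 1 ≤ √R := Real.one_le_sqrt.2 hR.le
  have hP0 : (0 : ℝ) < P := Nat.cast_pos.2 hP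
  obtain ⟨q, hq, ⟨⟨hx0, hxρ⟩, a, hau, haq, hxa⟩, hxs⟩ := hx
  simp only [goodDenoms, Finset.mem_filter, Finset.mem_Ioc] at hq
  obtain ⟨⟨hq0, hqQ⟩, hqε, -⟩ := hq
  push_cast at hqε
  have hq0' : (0 : ℝ) < q := Nat.cast_pos.2 hq0
  have : NeZero q := ⟨hq0.ne'⟩
  set ε : ℝ := 1 / (4 * 8 ^ d) with hε
  set lam : ℝ := 2 * Real.pi * R / D ^ 2 with hlamdef
  have hlam0 : 0 < lam := by positivity
  -- Chosen so that x₀ + 2tR vanishes at x₀ = lam · a/q; the sign is why the Gauss sum is applied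
  -- with -a.
  set t : ℝ := -(Real.pi * a / (q * D ^ 2)) with ht
  have hxt : x 0 + 2 * t * R = lam * (x 0 / lam - a / q) := by
    rw [mul_sub, mul_div_cancel₀ _ hlam0.ne', ht, hlamdef]; field_simp; ring
  have hxt' : √R * |x 0 + 2 * t * R| ≤ 1 / 8 := by
    rw [hxt, abs_mul, abs_of_pos hlam0]
    calc √R * (lam * |x 0 / lam - a / q|) ≤ √R * (lam * (1 / q)) := by gcongr
      _ = (√R * lam) / q := by ring
      _ ≤ 1 / 8 := by rw [div_le_iff₀ hq0']; linarith
  refine ⟨t, hxt', fun j hj => ?_⟩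
  have htR : |t| * R ≤ 1 / 8 := by
    have e0 : |x 0 + 2 * t * R| ≤ 1 / 8 :=
      le_trans (le_mul_of_one_le_left (abs_nonneg _) hsR1) hxt'
    have e1 : |t| * R = |t * R| := by rw [abs_mul, abs_of_pos hR0]
    rw [abs_le] at e0
    rw [e1, abs_le]
    constructor <;> linarith
  have ht8 : |t| ≤ 1 / 8 := le_trans (le_mul_of_one_le_right (abs_nonneg _) hR.le) htR
  have hxj := hxs j (Set.mem_univ j)
  simp only [hj, if_true] at hxj
  obtain ⟨⟨hxj0, hxjρ⟩, c, hc⟩ := hxj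
  have hqM : 16 * q ≤ M := le_trans (by omega) hPM
  have hkey := le_norm_integral_fejerBump (a := -a) (c := c) (M := M) (D := D) (x := x j.succ)
    (t := t) (q := q) (by rw [neg_mul]; exact haq.neg) (by push_cast; exact hau.neg) hD.le
    (by rw [ht]; push_cast; field_simp)
    (by rw [abs_of_nonneg hxj0]; linarith) hqM (by
      have h1 : D * x j.succ - 2 * Real.pi * c / q =
          2 * Real.pi * (D * x j.succ / (2 * Real.pi) - c / q) := by field_simp
      rw [h1, abs_mul, abs_of_pos (by positivity : 0 < 2 * Real.pi), mul_add]
      -- The allowance 1/64 is shared equally: the rational approximation, using qP ≥ εP^{d+1}, and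
      -- the drift 2D|t|, using DM ≤ R/32 and |t|R ≤ 1/8.
      have h2 : M * (2 * Real.pi * |D * x j.succ / (2 * Real.pi) - c / q|) ≤ 1 / 128 := by
        calc _ ≤ M * (2 * Real.pi * (1 / (q * P))) := by gcongr
          _ = (2 * Real.pi * M) / (q * P) := by ring
          _ ≤ 1 / 128 := by
            rw [div_le_iff₀ (by positivity)]
            have := mul_le_mul_of_nonneg_right hqε hP0.le
            linarith
      have h3 : M * (2 * D * |t|) ≤ 1 / 128 := by
        calc M * (2 * D * |t|) = 2 * (D * M) * |t| := by ring
          _ ≤ 2 * (R / 32) * |t| := by gcongr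
          _ = (|t| * R) / 16 := by ring
          _ ≤ 1 / 128 := by linarith
      linarith)
  refine le_trans ?_ hkey
  have hqQ' : (q : ℝ) ≤ (P : ℝ) ^ d := by exact_mod_cast hqQ
  calc (√(M / (P : ℝ) ^ d) / 2) * √((M : ℝ) ^ 3) = (M : ℝ) ^ 2 / (2 * √((P : ℝ) ^ d)) := by
        have e1 : √((M : ℝ) ^ 3) = M * √(M : ℝ) := by
          rw [pow_succ, Real.sqrt_mul (by positivity), Real.sqrt_sq (by positivity)]
        have e2 : √(M : ℝ) * √(M : ℝ) = M := Real.mul_self_sqrt (by positivity)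
        rw [e1, Real.sqrt_div (by positivity)]
        have : √(M : ℝ) / √((P : ℝ) ^ d) / 2 * (M * √(M : ℝ)) =
          (√(M : ℝ) * √(M : ℝ)) * M / (2 * √((P : ℝ) ^ d)) := by ring
        rw [this, e2]; ring
    _ ≤ (M : ℝ) ^ 2 / (2 * √q) := by
        have : 0 < √(q : ℝ) := Real.sqrt_pos.2 hq0'
        gcongr

/-! ### Choice of parameters and conclusion. -/

/-- The parameters of the construction at frequency `X ^ (2 d + 4)`. -/
theorem exists_parameters {k d K : ℕ} {X : ℝ} (hK : K = 4096 * (k + 1) * 16 ^ d)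
    (hX : 17 * K + 1 ≤ X) :
    ∃ (P M : ℕ) (D : ℝ), 0 < P ∧ 0 < M ∧ 1 ≤ D ∧
      2 * (2 * Real.pi * X ^ (2 * d + 4) / D ^ 2) ≤ 1 / (8 * (k + 1)) ∧
      1 ≤ 1 / (8 * (k + 1)) * D / (2 * Real.pi) ∧
      X ^ (d + 2) * (2 * Real.pi * X ^ (2 * d + 4) / D ^ 2) ≤
        1 / (4 * 8 ^ d) * (P : ℝ) ^ d / 8 ∧
      16 * P ^ d ≤ M ∧ D * M ≤ X ^ (2 * d + 4) / 32 ∧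
      2 * Real.pi * M ≤ 1 / (4 * 8 ^ d) * (P : ℝ) ^ d * P / 128 ∧
      X / (4 * K) ≤ M / (P : ℝ) ^ d := by
  have hpi := Real.pi_pos
  have hpi4 := Real.pi_lt_four
  have hk1 : (1 : ℝ) ≤ (k : ℝ) + 1 := by linarith [Nat.cast_nonneg (α := ℝ) k]
  have h16 : (1 : ℝ) ≤ 16 ^ d := one_le_pow₀ (by norm_num)
  have h8 : (1 : ℝ) ≤ 8 ^ d := one_le_pow₀ (by norm_num)
  have h816 : (8 : ℝ) ^ d ≤ 16 ^ d := by gcongr; norm_num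
  have hKr : (K : ℝ) = 4096 * (k + 1) * 16 ^ d := by rw [hK]; push_cast; ring
  have hK1 : (1 : ℝ) ≤ K := by
    have : 0 < K := by rw [hK]; positivity
    exact_mod_cast this
  -- L is the constant in D = L X^{d+3}; the ratio L / K = 1/64 gives DM ≤ X^{2d+4}/64.
  set L : ℝ := 64 * (k + 1) * 16 ^ d with hL
  have hLK : (K : ℝ) = 64 * L := by rw [hKr, hL]; ring
  have hL64 : 64 * 16 ^ d ≤ L := by
    calc (64 : ℝ) * 16 ^ d = 64 * 1 * 16 ^ d := by ring
      _ ≤ L := by rw [hL]; gcongr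
  have hL1 : 64 ≤ L := by linarith
  have hX1 : 1 ≤ X := by linarith
  have hX0 : 0 < X := by linarith
  set P : ℕ := ⌊X⌋₊ with hP
  have hPX : (P : ℝ) ≤ X := Nat.floor_le hX0.le
  have hXP : X < P + 1 := Nat.lt_floor_add_one X
  have hP17 : 17 * (K : ℝ) ≤ P := by linarith
  have hP1 : (1 : ℝ) ≤ P := by linarith
  have hX2P : X ≤ 2 * P := by linarith
  have hPd : (1 : ℝ) ≤ (P : ℝ) ^ d := one_le_pow₀ hP1
  set M : ℕ := ⌊(P : ℝ) ^ (d + 1) / K⌋₊ with hM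
  have hMle : (M : ℝ) ≤ (P : ℝ) ^ (d + 1) / K := Nat.floor_le (by positivity)
  have hMlt : (P : ℝ) ^ (d + 1) / K < M + 1 := Nat.lt_floor_add_one _
  -- 17 instead of 16, since the floor defining M may lose 1 ≤ P^d.
  have hPK : 17 * (P : ℝ) ^ d ≤ (P : ℝ) ^ (d + 1) / K := by
    rw [le_div_iff₀ (by linarith), pow_succ]
    calc 17 * (P : ℝ) ^ d * K = P ^ d * (17 * K) := by ring
      _ ≤ P ^ d * P := by gcongr
  have hM16 : 16 * (P : ℝ) ^ d ≤ M := by linarith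
  have hD2 : 2 * Real.pi * X ^ (2 * d + 4) / (L * X ^ (d + 3)) ^ 2 = 2 * Real.pi / (L ^ 2 * X ^ 2) := by
    have : X ^ (2 * d + 4) * X ^ 2 = (X ^ (d + 3)) ^ 2 := by ring
    rw [mul_pow, ← this]
    field_simp
  have hLρ : 1 / (8 * ((k : ℝ) + 1)) * L = 8 * 16 ^ d := by
    rw [hL]; field_simp; ring
  -- With this D the spacing lam = 2πR/D² is of order X^{-2}, so lam / q with q ~ X^d is of order
  -- X^{-(d+2)} = R^{-1/2}, the tolerance in x₀; and DM stays below R.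
  refine ⟨P, M, L * X ^ (d + 3), ?_, ?_, ?_, ?_, ?_, ?_, ?_, ?_, ?_, ?_⟩
  · exact_mod_cast (by linarith : (0 : ℝ) < P)
  · exact_mod_cast (by linarith : (0 : ℝ) < M)
  · exact one_le_mul_of_one_le_of_one_le (by linarith) (one_le_pow₀ hX1)
  · rw [hD2]
    have h1 : 1 ≤ X ^ 2 := one_le_pow₀ hX1
    calc 2 * (2 * Real.pi / (L ^ 2 * X ^ 2)) ≤ 2 * (2 * 4 / (L ^ 2 * 1)) := by gcongr
      _ = 16 / L ^ 2 := by ring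
      _ ≤ 1 / (8 * (k + 1)) := by
        rw [div_le_div_iff₀ (by positivity) (by positivity)]
        have hLk : 64 * ((k : ℝ) + 1) ≤ L := le_mul_of_one_le_right (by positivity) h16
        calc (16 : ℝ) * (8 * (k + 1)) ≤ 64 * (64 * (k + 1)) := by linarith
          _ ≤ L * L := by gcongr
          _ = 1 * L ^ 2 := by ring
  · rw [le_div_iff₀ (by positivity), ← mul_assoc (1 / (8 * ((k : ℝ) + 1))), hLρ]
    have := one_le_mul_of_one_le_of_one_le h16 (one_le_pow₀ hX1 : (1 : ℝ) ≤ X ^ (d + 3))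
    linarith
  · rw [hD2]
    have e1 : X ^ (d + 2) * (2 * Real.pi / (L ^ 2 * X ^ 2)) = 2 * Real.pi * X ^ d / L ^ 2 := by
      rw [pow_add]; field_simp
    rw [e1]
    calc 2 * Real.pi * X ^ d / L ^ 2 ≤ 2 * 4 * (2 * (P : ℝ)) ^ d / (64 * 16 ^ d) ^ 2 := by gcongr
      _ = 8 * 2 ^ d * (P : ℝ) ^ d / (4096 * (16 ^ d * 16 ^ d)) := by ring
      _ ≤ 8 * 2 ^ d * (P : ℝ) ^ d / (4096 * (16 ^ d * 1)) := by gcongr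
      _ = (P : ℝ) ^ d / (512 * 8 ^ d) := by
        have : (16 : ℝ) ^ d = 2 ^ d * 8 ^ d := by rw [← mul_pow]; norm_num
        rw [this]; field_simp; norm_num
      _ ≤ (P : ℝ) ^ d / (32 * 8 ^ d) := by gcongr; norm_num
      _ = 1 / (4 * 8 ^ d) * (P : ℝ) ^ d / 8 := by field_simp; norm_num
  · exact_mod_cast hM16
  · calc L * X ^ (d + 3) * M ≤ L * X ^ (d + 3) * (X ^ (d + 1) / K) := by
          gcongr
          exact hMle.trans (by gcongr)
      _ = L / K * (X ^ (d + 3) * X ^ (d + 1)) := by ring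
      _ = 1 / 64 * X ^ (2 * d + 4) := by
        have e1 : L / K = 1 / 64 := by rw [hLK]; field_simp
        rw [e1, ← pow_add]; ring_nf
      _ ≤ X ^ (2 * d + 4) / 32 := by linarith [pow_pos hX0 (2 * d + 4)]
  · calc 2 * Real.pi * M ≤ 2 * 4 * ((P : ℝ) ^ (d + 1) / (4096 * 8 ^ d)) := by
          gcongr
          refine hMle.trans ?_
          gcongr
          calc (4096 : ℝ) * 8 ^ d = 4096 * 1 * 8 ^ d := by ring
            _ ≤ 4096 * (k + 1) * 16 ^ d := by gcongr
            _ = K := hKr.symm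
      _ = 1 / (4 * 8 ^ d) * (P : ℝ) ^ d * P / 128 := by rw [pow_succ]; field_simp; norm_num
  · rw [div_le_div_iff₀ (by positivity) (by positivity)]
    have h1 : (P : ℝ) ^ (d + 1) / K ≤ 2 * M := by linarith
    rw [div_le_iff₀ (by linarith)] at h1
    calc X * (P : ℝ) ^ d ≤ 2 * P * P ^ d := by gcongr
      _ = 2 * P ^ (d + 1) := by ring
      _ ≤ 2 * (2 * M * K) := by gcongr
      _ = M * (4 * K) := by ring

theorem sqrt_pow_nat {X : ℝ} (hX : 0 ≤ X) (e : ℕ) : √(X ^ e) = √X ^ e := by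
  rw [Real.sqrt_eq_iff_mul_self_eq (by positivity) (by positivity), ← mul_pow,
    Real.mul_self_sqrt hX]

theorem proposition2p1 (m n : ℕ) (hm : 1 ≤ m) (hmn : m ≤ n) :
    ∃ C : ℝ, 1 ≤ C ∧ ∀ R : ℝ, 1 < R →
      ∃ f : Lp (α := EuclideanSpace ℝ (Fin n)) ℂ 2 volume,
        f ≠ 0 ∧
        (∀ᵐ ξ : EuclideanSpace ℝ (Fin n),
          ¬ (C⁻¹ * R ≤ ‖ξ‖ ∧ ‖ξ‖ ≤ C * R) → unitaryFourier f ξ = 0) ∧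
        ∃ E : Set (EuclideanSpace ℝ (Fin n)),
          MeasurableSet E ∧ E ⊆ Metric.ball 0 1 ∧
          C⁻¹ * R ^ (-((n : ℝ) - m) / 2) ≤ volume.real E ∧
          volume.real E ≤ C * R ^ (-((n : ℝ) - m) / 2) ∧
          ∀ x ∈ E, ∃ t : ℝ,
            |t - (-(x ⟨0, by omega⟩) / (2 * R))| ≤ C * R ^ (-(3 : ℝ) / 2) ∧
            C⁻¹ * (R ^ ((m : ℝ) / (2 * (m + 1))) * R ^ (((n : ℝ) - m) / 4)) ≤
              ‖schrodinger t f x‖ / ‖f‖ := by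
  obtain ⟨d, rfl⟩ : ∃ d, m = d + 1 := ⟨m - 1, by omega⟩
  obtain ⟨k, rfl⟩ : ∃ k, n = k + 1 := ⟨n - 1, by omega⟩
  have hd : d ≤ k := by omega
  obtain ⟨K, hK⟩ : ∃ K : ℕ, K = 4096 * (k + 1) * 16 ^ d := ⟨_, rfl⟩
  have hK0 : (0 : ℝ) < K := by rw [hK]; positivity
  set ρ : ℝ := 1 / (8 * (k + 1)) with hρ
  have hρ0 : 0 < ρ := by positivity
  have hρ1 : 8 * (k + 1) * ρ ≤ 1 := by rw [hρ, mul_one_div_cancel (by positivity)]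
  have hρ8 : ρ ≤ 1 / 8 := by
    rw [hρ]; gcongr; linarith [Nat.cast_nonneg (α := ℝ) k]
  set c : ℝ := (2 * Real.pi) ^ (-((k + 1 : ℕ) : ℝ) / 2) * (1 / 2) ^ (k + 1) with hc
  have hc0 : 0 < c := by positivity
  set N : ℝ := (17 * K + 1) ^ (d + 1) with hN
  have hN0 : 0 < N := by positivity
  set v₁ : ℝ := ρ ^ (k + 1) with hv₁
  set v₂ : ℝ := Real.exp (-2 * (4 * 8 ^ d)) * ρ ^ (k + 1) / 8 with hv₂
  set a₁ : ℝ := (1 / 2) ^ d / N with ha₁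
  set a₂ : ℝ := (1 / (4 * √K)) ^ d with ha₂
  have hv₁0 : 0 < v₁ := by positivity
  have hv₂0 : 0 < v₂ := by positivity
  have ha₁0 : 0 < c * a₁ := by positivity
  have ha₂0 : 0 < c * a₂ := by positivity
  have i1 := inv_pos.2 hv₁0
  have i2 := inv_pos.2 hv₂0
  have i3 := inv_pos.2 ha₁0
  have i4 := inv_pos.2 ha₂0
  have hk0 : (0 : ℝ) ≤ k := Nat.cast_nonneg k
  -- A sum of positive terms dominates each of them, so one C serves both ranges of R.
  obtain ⟨C, hC⟩ : ∃ C : ℝ, C = 2 * (k + 1) + v₁⁻¹ + v₂⁻¹ + (c * a₁)⁻¹ + (c * a₂)⁻¹ := ⟨_, rfl⟩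
  refine ⟨C, by linarith, fun R hR => ?_⟩
  have hR0 : 0 < R := by linarith
  have hd2 : (0 : ℝ) < 2 * (d + 2) := by positivity
  set X : ℝ := R ^ (1 / (2 * ((d : ℝ) + 2))) with hX
  have hX0 : 0 < X := by positivity
  have hXR : X ^ (2 * d + 4) = R := by
    rw [hX, ← Real.rpow_natCast, ← Real.rpow_mul hR0.le]
    push_cast
    rw [show 1 / (2 * ((d : ℝ) + 2)) * (2 * d + 4) = 1 by field_simp; ring, Real.rpow_one]
  have hXd : R ^ (((d : ℝ) + 1) / (2 * (d + 2))) = X ^ (d + 1) := by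
    rw [hX, ← Real.rpow_natCast, ← Real.rpow_mul hR0.le]
    congr 1; push_cast; ring
  have hsR : √R = X ^ (d + 2) := by
    rw [← hXR, show X ^ (2 * d + 4) = (X ^ (d + 2)) ^ 2 by ring, Real.sqrt_sq (by positivity)]
  have hCinv : ∀ v : ℝ, 0 < v → v⁻¹ ≤ C → C⁻¹ ≤ v := fun v hv h => inv_le_of_inv_le₀ hv h
  -- Below the threshold R is bounded and the required gain X^{d+1} is absorbed by N; above it the
  -- parameters exist.
  rcases lt_or_ge X (17 * K + 1) with hsmall | hlarge
  · refine exists_datum_of_largeSet (D := 1) (M := 1) (A := 1 / 2) (v := v₁) (a := a₁) (ρ := ρ)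
      hd hR le_rfl (by push_cast; linarith) one_pos (by norm_num) hρ0 hρ1 hv₁0
      (measurableSet_spaceBox k d ρ R) subset_rfl (volume_spaceBox hd hρ0.le R).ge ?_
      (by linarith) (hCinv _ hv₁0 (by linarith)) (hCinv _ ha₁0 (by linarith)) ?_
    · rw [hXd, ha₁]
      have h1 : X ^ (d + 1) ≤ N := by rw [hN]; gcongr
      have h2 : 1 ≤ √√R := Real.one_le_sqrt.2 (Real.one_le_sqrt.2 hR.le)
      calc (1 / 2 : ℝ) ^ d / N * X ^ (d + 1) ≤ (1 / 2) ^ d / N * N := by gcongr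
        _ = 1 * (1 / 2) ^ d := by field_simp
        _ ≤ √√R * (1 / 2) ^ d := by gcongr
    · intro x hx
      refine ⟨-(x 0) / (2 * R), ?_, fun j _ => ?_⟩
      · have : x 0 + 2 * (-(x 0) / (2 * R)) * R = 0 := by field_simp; ring
        rw [this]; simp
      · have h0 := mem_Ico_of_mem_spaceBox hρ0.le hR.le hx 0
        have hj := mem_Ico_of_mem_spaceBox hρ0.le hR.le hx j.succ
        have ht : |-(x 0) / (2 * R)| ≤ 1 / 8 := by
          rw [abs_div, abs_neg, abs_of_nonneg h0.1, abs_of_pos (by positivity : 0 < 2 * R),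
            div_le_iff₀ (by positivity)]
          nlinarith [h0.2]
        have h := half_le_norm_integral_fejerBump_one (x := x j.succ) (t := -(x 0) / (2 * R))
          (by rw [abs_of_nonneg hj.1]; linarith [hj.2])
        simpa using h
  · obtain ⟨P, M, D, hP, hM, hD1, hD2, hD3, hD4, hPM, hDM, hMP, hA⟩ := exists_parameters hK hlarge
    rw [hXR] at hD2 hD4 hDM
    rw [← hsR] at hD4
    have hP0 : (0 : ℝ) < P := Nat.cast_pos.2 hP
    have hM0 : (0 : ℝ) < M := Nat.cast_pos.2 hM
    have hA0 : 0 < √(M / (P : ℝ) ^ d) / 2 := by positivity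
    refine exists_datum_of_largeSet (D := D) (M := M) (A := √(M / (P : ℝ) ^ d) / 2) (v := v₂)
      (a := a₂) (ρ := ρ) hd hR hD1 (by linarith) hM hA0 hρ0 hρ1 hv₂0
      (measurableSet_largeSet k d R D ρ P) (largeSet_subset_spaceBox k d R D ρ P)
      (le_volume_largeSet hd hR0 (by linarith) hP hρ0.le hD2 hD3) ?_
      (by linarith) (hCinv _ hv₂0 (by linarith)) (hCinv _ ha₂0 (by linarith))
      (fun x hx => exists_time_of_mem_largeSet hR (by linarith) hP hρ8 hD4 hPM hDM hMP hx)
    have h1 : √X * (1 / (4 * √K)) ≤ √(M / (P : ℝ) ^ d) / 2 := by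
      have e1 : √(X / (4 * K)) = √X / (2 * √K) := by
        rw [Real.sqrt_div hX0.le, Real.sqrt_mul (by norm_num), show (4 : ℝ) = 2 ^ 2 by norm_num,
          Real.sqrt_sq (by norm_num)]
      have e2 := Real.sqrt_le_sqrt hA
      rw [e1] at e2
      calc √X * (1 / (4 * √K)) = √X / (2 * √K) / 2 := by ring
        _ ≤ _ := by gcongr
    rw [hXd, hsR, sqrt_pow_nat hX0.le]
    -- The exponents of X add up as (d+2)/2 from the first factor and d/2 from the middle ones.
    calc a₂ * X ^ (d + 1) = √X ^ (d + 2) * (√X * (1 / (4 * √K))) ^ d := by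
          have : X ^ (d + 1) = √X ^ (d + 2) * √X ^ d := by
            conv_lhs => rw [← Real.sq_sqrt hX0.le]
            ring
          rw [this, ha₂, mul_pow]; ring
      _ ≤ √X ^ (d + 2) * (√(M / (P : ℝ) ^ d) / 2) ^ d := by gcongr
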